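/- Let $\mathbb{C}(q)$ be the field of rational functions in $q$ and put $\mathfrak{q}=q^2$. Let $U^{>}_q(L\mathfrak{sl}_2)$ be the associative unital $\mathbb{C}(q)$-algebra generated by $\{e_r\}_{r\in\mathbb{Z}}$ with the defining relation $$(z-q^{2}w)\,e(z)e(w)=(q^{2}z-w)\,e(w)e(z),\qquad e(z)=\sum_{r\in\mathbb{Z}}e_rz^{-r}.$$ Write $[a,b]_x:=ab-x\cdot ba$. For $n\in\mathbb{Z}$ put $M_{0,n}:=1$, $M_{1,n}:=e_{-n}$ and, for $k\geq 1$, $$M_{k,n}:=\frac{(-1)^{\frac{k(k-1)}{2}}}{(1-\mathfrak{q})^{k-1}}\,[\cdots[[M_{1,n-k+1},M_{1,n-k+3}]_{\mathfrak{q}^2},M_{1,n-k+5}]_{\mathfrak{q}^3},\cdots,M_{1,n+k-1}]_{\mathfrak{q}^{k}}$$ (for $k=1$ the right-hand side is just $M_{1,n}$). Then these elements satisfy the quantum $M$-system relation $$M_{\alpha,n}^2-\mathfrak{q}^{\alpha}M_{\alpha,n+1}M_{\alpha,n-1}=M_{\alpha+1,n}M_{\alpha-1,n}\qquad\text{for all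 integers }\alpha\geq 1,\ n\in\mathbb{Z}.$$ -/

import Mathlib

/-- The ground field `ℂ(q)`, rational functions in one variable over `ℂ`. -/
abbrev QField : Type := RatFunc ℂ

/-- The variable `q` of `ℂ(q)`. -/
noncomputable def qVar : QField := RatFunc.X

/-- The parameter `𝔮 = q ^ 2`. -/
noncomputable def qFrak : QField := qVar ^ 2

/-- The defining relations of `U^>_q(L sl₂)`. With `e(z) = ∑ r, e_r z^{-r}`, the relation
`(z - q² w) e(z) e(w) = (q² z - w) e(w) e(z)` is the family of equalities of the coefficients
of `z^{-a} w^{-b}` on both sides, for all integers `a`, `b`. (There are no Serre relations, since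
`sl₂` has a single simple root.) -/
inductive UPosRel : FreeAlgebra QField ℤ → FreeAlgebra QField ℤ → Prop
  | quadratic (a b : ℤ) : UPosRel
      (FreeAlgebra.ι QField (a + 1) * FreeAlgebra.ι QField b
        - qVar ^ 2 • (FreeAlgebra.ι QField a * FreeAlgebra.ι QField (b + 1)))
      (qVar ^ 2 • (FreeAlgebra.ι QField b * FreeAlgebra.ι QField (a + 1))
        - FreeAlgebra.ι QField (b + 1) * FreeAlgebra.ι QField a)

/-- `U^>_q(L sl₂)`: the associative unital `ℂ(q)`-algebra generated by `e_r`, `r ∈ ℤ`, with the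
defining relations `UPosRel`. -/
def UPos : Type := RingQuot UPosRel

noncomputable instance : Ring UPos := inferInstanceAs (Ring (RingQuot UPosRel))

noncomputable instance : Algebra QField UPos := inferInstanceAs (Algebra QField (RingQuot UPosRel))

/-- The quotient map from the free algebra on the symbols `e_r` to `U^>_q(L sl₂)`. -/
noncomputable def UPos.mk : FreeAlgebra QField ℤ →ₐ[QField] UPos :=
  RingQuot.mkAlgHom QField UPosRel

/-- The generator `e_r` of `U^>_q(L sl₂)`. -/
noncomputable def eGen (r : ℤ) : UPos :=
  UPos.mk (FreeAlgebra.ι QField r)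

/-- The `x`-commutator `[a, b]_x = a b - x · b a`. -/
noncomputable def xComm (x : QField) (a b : UPos) : UPos := a * b - x • (b * a)

/-- `M_{1,n} = e_{-n}`. -/
noncomputable def mOne (n : ℤ) : UPos := eGen (-n)

/-- The iterated commutator
`[⋯[[M_{1,m}, M_{1,m+2}]_{𝔮²}, M_{1,m+4}]_{𝔮³}, ⋯, M_{1,m+2j}]_{𝔮^{j+1}}` of `j + 1` elements;
for `j = 0` it is `M_{1,m}`. -/
noncomputable def mIter (m : ℤ) : ℕ → UPos
  | 0 => mOne m
  | j + 1 => xComm (qFrak ^ (j + 2)) (mIter m j) (mOne (m + 2 * ((j : ℤ) + 1)))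

/-- The elements `M_{k,n}`: `M_{0,n} = 1` and, for `k ≥ 1`,
`M_{k,n} = (-1)^{k(k-1)/2} (1-𝔮)^{-(k-1)}
  [⋯[[M_{1,n-k+1}, M_{1,n-k+3}]_{𝔮²}, M_{1,n-k+5}]_{𝔮³}, ⋯, M_{1,n+k-1}]_{𝔮^k}`. -/
noncomputable def mElt : ℕ → ℤ → UPos
  | 0, _ => 1
  | k + 1, n => ((-1) ^ ((k + 1) * k / 2) / (1 - qFrak) ^ k : QField) • mIter (n - k) k

/-! The algebra is realised by shuffle products. Given variables `z i` in a field over ℂ(q) and T =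
𝔮, it acts on functions of finite sets of variables, with `eGen r` acting as left shuffle
multiplication by z^r. The usual kernel (z_j - T z_i) / (z_j - z_i) is divided by the symmetric
factor (z_i - T z_j)(z_j - T z_i). In this normalisation `mElt k n` becomes multiplication by the
pure monomial ∏ z_i ^ (-n - k + 1) in k variables (`shuffleRep_mElt`); the commutator computation
behind this is Lagrange interpolation of the constant 1 (`sum_prod_lagrange_eq_one`).

After division by a common monomial, the M-system relation is a rational identity: a weighted sum
over subsets of 2m variables vanishes (`weightedSubsetSum_relCoeff_eq_zero`). It is proved by
induction on m. Clearing denominators in one variable X leaves a polynomial with more zeros than its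
degree allows: it vanishes at X = z_s because the poles there cancel, and at X = T z_s and X = z_s /
T because there it reduces to the same sum with two variables fewer.

It remains to see that enough of the action is faithful (`eq_zero_of_shuffleRep_eq_zero`). The
quadratic relation shows that weakly decreasing monomials in the generators span each degree. Their
shuffle images are linearly independent: sending one variable to infinity, the leading coefficient
strips one letter off the list and multiplies by a geometric sum in T⁻¹, nonzero because T is not a
root of unity. -/

/-! ### Shuffle products on functions of finite sets. -/

section Shuffle

open Finset

variable {ι L : Type*} [DecidableEq ι] [Field L]

/-- The product of `w i j` over all pairs in `I × J`. -/
def crossProd (w : ι → ι → L) (I J : Finset ι) : L := ∏ i ∈ I, ∏ j ∈ J, w i j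

theorem crossProd_union_right (w : ι → ι → L) {I J K : Finset ι} (h : Disjoint J K) :
    crossProd w I (J ∪ K) = crossProd w I J * crossProd w I K := by
  simp only [crossProd, prod_union h, prod_mul_distrib]

theorem crossProd_union_left (w : ι → ι → L) {I J K : Finset ι} (h : Disjoint I J) :
    crossProd w (I ∪ J) K = crossProd w I K * crossProd w J K := by
  simp only [crossProd, prod_union h]

theorem crossProd_insert_left (w : ι → ι → L) {I J : Finset ι} {a : ι} (h : a ∉ I) :
    crossProd w (insert a I) J = (∏ j ∈ J, w a j) * crossProd w I J := by
  simp only [crossProd, prod_insert h]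

theorem crossProd_insert_right (w : ι → ι → L) {I J : Finset ι} {a : ι} (h : a ∉ J) :
    crossProd w I (insert a J) = (∏ i ∈ I, w i a) * crossProd w I J := by
  simp only [crossProd, prod_insert h, prod_mul_distrib]

/-- The shuffle product with kernel `w` of two functions on finite sets of variables. -/
def shuffleConv (w : ι → ι → L) (G F : Finset ι → L) (S : Finset ι) : L :=
  ∑ I ∈ S.powerset, G I * F (S \ I) * crossProd w I (S \ I)

/-- Both sides sum over ordered partitions of `S` into three blocks, with the kernel taken over all
pairs from an earlier and a later block. Associativity is what turns left multiplication into an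
action. -/
theorem shuffleConv_assoc (w : ι → ι → L) (G H F : Finset ι → L) :
    shuffleConv w (shuffleConv w G H) F = shuffleConv w G (shuffleConv w H F) := by
  funext S
  simp only [shuffleConv, sum_mul, mul_sum]
  rw [sum_sigma', sum_sigma']
  refine sum_nbij' (fun p => ⟨p.2, p.1 \ p.2⟩) (fun p => ⟨p.1 ∪ p.2, p.1⟩) ?_ ?_ ?_ ?_ ?_
  · rintro ⟨T, I⟩ h
    simp only [mem_sigma, mem_powerset] at h ⊢
    exact ⟨h.2.trans h.1, sdiff_subset_sdiff h.1 le_rfl⟩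
  · rintro ⟨I, J⟩ h
    simp only [mem_sigma, mem_powerset] at h ⊢
    exact ⟨union_subset h.1 (h.2.trans sdiff_subset), subset_union_left⟩
  · rintro ⟨T, I⟩ h
    simp only [mem_sigma, mem_powerset] at h
    simp [union_sdiff_of_subset h.2]
  · rintro ⟨I, J⟩ h
    simp only [mem_sigma, mem_powerset] at h
    have hd : Disjoint J I := (subset_sdiff.1 h.2).2
    simp [union_sdiff_left, sdiff_eq_self_of_disjoint hd]
  · rintro ⟨T, I⟩ h
    simp only [mem_sigma, mem_powerset] at h
    obtain ⟨hT, hI⟩ := h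
    have e1 : (S \ I) \ (T \ I) = S \ T := by
      ext x; simp only [mem_sdiff]; have := @hI x; tauto
    have e2 : S \ I = (T \ I) ∪ (S \ T) := by
      ext x; simp only [mem_sdiff, mem_union]; have := @hI x; have := @hT x; tauto
    have d2 : Disjoint (T \ I) (S \ T) := by
      rw [disjoint_left]; intro x; simp only [mem_sdiff]; tauto
    have e3 : crossProd w T (S \ T) = crossProd w I (S \ T) * crossProd w (T \ I) (S \ T) := by
      rw [← crossProd_union_left w disjoint_sdiff, union_sdiff_of_subset hI]
    simp only
    rw [e1, e3]
    rw [show crossProd w I (S \ I) = crossProd w I (T \ I) * crossProd w I (S \ T) by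
      rw [e2, crossProd_union_right w d2]]
    ring

/-- The function `I ↦ ∏_{i ∈ I} z_i ^ a` on sets of cardinality `k`, extended by zero. -/
def monomialFun (z : ι → L) (k : ℕ) (a : ℤ) (I : Finset ι) : L :=
  if I.card = k then ∏ i ∈ I, z i ^ a else 0

theorem shuffleConv_monomialFun_one (w : ι → ι → L) (z : ι → L) (r : ℤ) (F : Finset ι → L)
    (S : Finset ι) :
    shuffleConv w (monomialFun z 1 r) F S
      = ∑ a ∈ S, z a ^ r * (∏ b ∈ S.erase a, w a b) * F (S.erase a) := by
  have h1 : shuffleConv w (monomialFun z 1 r) F S = ∑ I ∈ S.powersetCard 1,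
      monomialFun z 1 r I * F (S \ I) * crossProd w I (S \ I) := by
    rw [shuffleConv, ← sum_filter_add_sum_filter_not S.powerset (fun I => I.card = 1),
      ← powersetCard_eq_filter, add_eq_left]
    refine sum_eq_zero fun I hI => ?_
    rw [mem_filter] at hI
    simp [monomialFun, hI.2]
  rw [h1, powersetCard_one, sum_map]
  refine sum_congr rfl fun a _ => ?_
  simp [monomialFun, crossProd, sdiff_singleton_eq_erase]
  ring

theorem shuffleConv_monomialFun_one_right (w : ι → ι → L) (z : ι → L) (r : ℤ) (F : Finset ι → L)
    (S : Finset ι) :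
    shuffleConv w F (monomialFun z 1 r) S
      = ∑ a ∈ S, z a ^ r * (∏ b ∈ S.erase a, w b a) * F (S.erase a) := by
  have h0 : shuffleConv w F (monomialFun z 1 r) S = ∑ I ∈ S.powerset,
      F (S \ I) * monomialFun z 1 r I * crossProd w (S \ I) I := by
    rw [shuffleConv]
    refine sum_nbij' (fun I => S \ I) (fun I => S \ I) ?_ ?_ ?_ ?_ ?_ <;> intro I hI <;>
      simp only [mem_powerset] at hI ⊢ <;> simp [Finset.sdiff_sdiff_eq_self hI, hI]
  have h1 : shuffleConv w F (monomialFun z 1 r) S = ∑ I ∈ S.powersetCard 1,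
      F (S \ I) * monomialFun z 1 r I * crossProd w (S \ I) I := by
    rw [h0, ← sum_filter_add_sum_filter_not S.powerset (fun I => I.card = 1),
      ← powersetCard_eq_filter, add_eq_left]
    refine sum_eq_zero fun I hI => ?_
    rw [mem_filter] at hI
    simp [monomialFun, hI.2]
  rw [h1, powersetCard_one, sum_map]
  refine sum_congr rfl fun a _ => ?_
  simp [monomialFun, crossProd, sdiff_singleton_eq_erase]
  ring

/-- The kernel `1 / ((z_j - z_i) (z_i - T z_j))` of the shuffle product. -/
def shuffleKer (T : L) (z : ι → L) (i j : ι) : L := ((z j - z i) * (z i - T * z j))⁻¹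

/-- A family of nonzero elements whose pairwise ratios avoid `1`, `T` and `T ^ 2`. -/
structure IsGenericFamily (T : L) (z : ι → L) : Prop where
  ne_zero : ∀ i, z i ≠ 0
  ne : ∀ i j, i ≠ j → z i ≠ z j
  ne_mul : ∀ i j, i ≠ j → z i ≠ T * z j
  ne_sq_mul : ∀ i j, i ≠ j → z i ≠ T ^ 2 * z j

theorem monomialFun_one_conv_of_card_ne {w : ι → ι → L} {z : ι → L} {a b : ℤ} {S : Finset ι}
    (hS : S.card ≠ 2) : shuffleConv w (monomialFun z 1 a) (monomialFun z 1 b) S = 0 := by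
  rw [shuffleConv_monomialFun_one]
  refine sum_eq_zero fun i hi => ?_
  have : (S.erase i).card ≠ 1 := by
    rw [card_erase_of_mem hi]; have := card_pos.2 ⟨i, hi⟩; omega
  simp [monomialFun, this]

theorem monomialFun_one_conv_pair {w : ι → ι → L} {z : ι → L} {a b : ℤ} {i j : ι} (h : i ≠ j) :
    shuffleConv w (monomialFun z 1 a) (monomialFun z 1 b) {i, j}
      = z i ^ a * z j ^ b * w i j + z j ^ a * z i ^ b * w j i := by
  rw [shuffleConv_monomialFun_one, sum_pair h]
  have h1 : ({i, j} : Finset ι).erase i = {j} := by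
    ext x; simp only [mem_erase, mem_insert, mem_singleton]; grind
  have h2 : ({i, j} : Finset ι).erase j = {i} := by
    ext x; simp only [mem_erase, mem_insert, mem_singleton]; grind
  simp only [h1, h2, monomialFun, card_singleton, if_true, prod_singleton]
  ring

/-- Moving everything to one side, the terms with the first kernel collect the factor x - T y, which
cancels and leaves (xa yb + xb ya) / (y - x). The other kernel gives the same symmetric numerator
over x - y. -/
theorem shuffleKer_quadratic {x y T : L} (h3 : x - T * y ≠ 0)
    (h4 : y - T * x ≠ 0) (xa xb ya yb : L) :
    xa * x * yb * ((y - x) * (x - T * y))⁻¹ + ya * y * xb * ((x - y) * (y - T * x))⁻¹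
        - T * (xa * (yb * y) * ((y - x) * (x - T * y))⁻¹
          + ya * (xb * x) * ((x - y) * (y - T * x))⁻¹)
      = T * (xb * (ya * y) * ((y - x) * (x - T * y))⁻¹ + yb * (xa * x) * ((x - y) * (y - T * x))⁻¹)
        - (xb * x * ya * ((y - x) * (x - T * y))⁻¹ + yb * y * xa * ((x - y) * (y - T * x))⁻¹) := by
  have e : y - x = -(x - y) := by ring
  rw [e, neg_mul, inv_neg, mul_inv, mul_inv]
  have hp := inv_mul_cancel₀ h3
  have hq := inv_mul_cancel₀ h4
  linear_combination (x - y)⁻¹ * (ya * xb + xa * yb) * (hq - hp)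

end Shuffle

/-! ### The action of the algebra by shuffle multiplication. -/

section Representation

open Finset

variable {ι L : Type*} [DecidableEq ι] [Field L] [Algebra QField L]

/-- Left shuffle multiplication, as a linear endomorphism. -/
def shuffleEnd (w : ι → ι → L) (G : Finset ι → L) : Module.End QField (Finset ι → L) where
  toFun F := shuffleConv w G F
  map_add' F F' := by
    funext S
    simp only [shuffleConv, Pi.add_apply, ← sum_add_distrib]
    exact sum_congr rfl fun I _ => by ring
  map_smul' c F := by
    funext S
    simp only [shuffleConv, Pi.smul_apply, smul_sum, RingHom.id_apply]
    exact sum_congr rfl fun I _ => by simp only [Algebra.smul_def]; ring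

theorem shuffleEnd_apply (w : ι → ι → L) (G F : Finset ι → L) :
    shuffleEnd w G F = shuffleConv w G F := rfl

theorem shuffleEnd_mul (w : ι → ι → L) (G H : Finset ι → L) :
    shuffleEnd w G * shuffleEnd w H = shuffleEnd w (shuffleConv w G H) := by
  ext1 F
  exact (shuffleConv_assoc w G H F).symm

theorem shuffleEnd_sub (w : ι → ι → L) (G H : Finset ι → L) :
    shuffleEnd w (G - H) = shuffleEnd w G - shuffleEnd w H := by
  ext F S
  simp only [shuffleEnd_apply, LinearMap.sub_apply, Pi.sub_apply, shuffleConv,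
    ← sum_sub_distrib]
  exact sum_congr rfl fun I _ => by ring

theorem shuffleEnd_smul (w : ι → ι → L) (c : QField) (G : Finset ι → L) :
    shuffleEnd w (c • G) = c • shuffleEnd w G := by
  ext F S
  simp only [shuffleEnd_apply, LinearMap.smul_apply, Pi.smul_apply, shuffleConv, smul_sum]
  exact sum_congr rfl fun I _ => by simp only [Algebra.smul_def]; ring

/-- Only two-element sets contribute, so the defining relation reduces to the two-variable identity
`shuffleKer_quadratic`. -/
theorem monomialFun_quadratic {z : ι → L} (hz : IsGenericFamily (algebraMap QField L qFrak) z)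
    (a b : ℤ) :
    let w := shuffleKer (algebraMap QField L qFrak) z
    shuffleConv w (monomialFun z 1 (a + 1)) (monomialFun z 1 b)
        - qFrak • shuffleConv w (monomialFun z 1 a) (monomialFun z 1 (b + 1))
      = qFrak • shuffleConv w (monomialFun z 1 b) (monomialFun z 1 (a + 1))
        - shuffleConv w (monomialFun z 1 (b + 1)) (monomialFun z 1 a) := by
  intro w
  funext S
  simp only [Pi.sub_apply, Pi.smul_apply]
  simp only [Algebra.smul_def]
  by_cases hS : S.card = 2
  · obtain ⟨i, j, hij, rfl⟩ := card_eq_two.1 hS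
    simp only [monomialFun_one_conv_pair hij, w, shuffleKer]
    have h3 := sub_ne_zero.2 (hz.ne_mul i j hij)
    have h4 := sub_ne_zero.2 (hz.ne_mul j i hij.symm)
    simp only [zpow_add_one₀ (hz.ne_zero i), zpow_add_one₀ (hz.ne_zero j)]
    exact shuffleKer_quadratic h3 h4 _ _ _ _
  · simp only [monomialFun_one_conv_of_card_ne hS]
    ring

/-- The action of `U^>_q(L sl₂)` on functions of finite sets of variables. -/
noncomputable def shuffleRep (z : ι → L)
    (hz : IsGenericFamily (algebraMap QField L qFrak) z) :
    UPos →ₐ[QField] Module.End QField (Finset ι → L) :=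
  RingQuot.liftAlgHom QField ⟨FreeAlgebra.lift QField fun r : ℤ =>
    shuffleEnd (shuffleKer (algebraMap QField L qFrak) z) (monomialFun z 1 r), by
      rintro _ _ ⟨a, b⟩
      have h := monomialFun_quadratic hz a b
      simp only [map_sub, map_smul, map_mul, FreeAlgebra.lift_ι_apply, shuffleEnd_mul]
      rw [← qFrak, ← shuffleEnd_smul, ← shuffleEnd_smul, ← shuffleEnd_sub, ← shuffleEnd_sub]
      exact congrArg _ h⟩

theorem shuffleRep_eGen (z : ι → L) (hz : IsGenericFamily (algebraMap QField L qFrak) z) (r : ℤ) :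
    shuffleRep z hz (eGen r)
      = shuffleEnd (shuffleKer (algebraMap QField L qFrak) z) (monomialFun z 1 r) := by
  have h : shuffleRep z hz (eGen r) = FreeAlgebra.lift QField (fun r : ℤ =>
    shuffleEnd (shuffleKer (algebraMap QField L qFrak) z) (monomialFun z 1 r))
      (FreeAlgebra.ι QField r) := RingQuot.liftAlgHom_mkAlgHom_apply _ _ _ _
  rw [h, FreeAlgebra.lift_ι_apply]

end Representation

/-! ### Commutators of monomials through Lagrange interpolation. -/

section CommutatorIdentity

open Finset

variable {ι L : Type*} [DecidableEq ι] [Field L]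

theorem disjSum_erase_inl (S : Finset ι) (l : ι) :
    (S.disjSum S).erase (Sum.inl l) = (S.erase l).disjSum S := by
  ext x; cases x <;> simp

theorem disjSum_erase_inr (S : Finset ι) (l : ι) :
    (S.disjSum S).erase (Sum.inr l) = S.disjSum (S.erase l) := by
  ext x; cases x <;> simp

/-- Lagrange interpolation of the constant `1` at the points `z_l` and `z_l / T`, evaluated
at `0`. -/
theorem sum_prod_lagrange_eq_one {T : L} (hT0 : T ≠ 0) (hT1 : T ≠ 1) {z : ι → L}
    (hz : IsGenericFamily T z) {S : Finset ι} (hS : S.Nonempty) :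
    ∑ l ∈ S, ((∏ i ∈ S.erase l, z i / (z i - z l)) * ∏ i ∈ S, z i / (z i - T * z l)) +
      ∑ l ∈ S, ((∏ i ∈ S, T * z i / (T * z i - z l)) * ∏ i ∈ S.erase l, z i / (z i - z l)) = 1 := by
  have hinj : Set.InjOn (Sum.elim z fun i => z i / T) (S.disjSum S : Finset (ι ⊕ ι)) := by
    rintro (i | i) _ (j | j) _ h <;> simp only [Sum.elim_inl, Sum.elim_inr] at h
    · by_contra hne; exact hz.ne i j (by simpa using hne) h
    · rw [eq_div_iff hT0] at h
      by_cases hij : i = j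
      · subst hij
        exact absurd (mul_left_cancel₀ (hz.ne_zero i) (h.trans (mul_one _).symm)) hT1
      · exact absurd (by rw [← h, mul_comm]) (hz.ne_mul j i (Ne.symm hij))
    · rw [div_eq_iff hT0] at h
      by_cases hij : i = j
      · subst hij
        exact absurd (mul_left_cancel₀ (hz.ne_zero i) (h.symm.trans (mul_one _).symm)) hT1
      · exact absurd (by rw [h, mul_comm]) (hz.ne_mul i j hij)
    · by_contra hne
      exact hz.ne i j (by simpa using hne) (by field_simp at h; exact h)
  have h := congrArg (Polynomial.eval (0 : L)) (Lagrange.sum_basis hinj (by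
    obtain ⟨i, hi⟩ := hS; exact ⟨Sum.inl i, Finset.inl_mem_disjSum.2 hi⟩))
  simp only [Polynomial.eval_finsetSum, Polynomial.eval_add, Polynomial.eval_one, sum_disjSum, Lagrange.basis,
    Polynomial.eval_prod, Lagrange.basisDivisor, disjSum_erase_inl, disjSum_erase_inr,
    prod_disjSum, Sum.elim_inl, Sum.elim_inr, Polynomial.eval_mul, Polynomial.eval_sub,
    Polynomial.eval_C, Polynomial.eval_X, zero_sub] at h
  rw [← h]
  congr 1 <;> refine sum_congr rfl fun l hl => ?_ <;> congr 1 <;> refine prod_congr rfl fun i hi => ?_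
  · have := sub_ne_zero.2 (hz.ne i l (ne_of_mem_erase hi))
    have h2 : z l - z i ≠ 0 := sub_ne_zero.2 (hz.ne l i (ne_of_mem_erase hi).symm)
    field_simp
    ring
  · have e : z l - z i / T = -(z i - T * z l) / T := by field_simp; ring
    rw [e]
    by_cases h0 : z i - T * z l = 0
    · simp [h0]
    · field_simp
  · have e : z l / T - z i = -(T * z i - z l) / T := by field_simp; ring
    rw [e]
    by_cases h0 : T * z i - z l = 0
    · simp [h0]
    · field_simp
  · have := sub_ne_zero.2 (hz.ne i l (ne_of_mem_erase hi))
    have h2 : z l - z i ≠ 0 := sub_ne_zero.2 (hz.ne l i (ne_of_mem_erase hi).symm)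
    have e : z l / T - z i / T = (z l - z i) / T := by ring
    rw [e]
    field_simp
    ring

/-- This is the interpolation identity rescaled. The diagonal factor i = l equals 1 / (1 - T) at the
node z_l and -T / (1 - T) at the node z_l / T; the extra -T supplies the minus sign and raises T^k
to T^(k+1). -/
theorem sum_shuffleKer_sub {T : L} (hT0 : T ≠ 0) (hT1 : T ≠ 1) {z : ι → L}
    (hz : IsGenericFamily T z) {S : Finset ι} {k : ℕ} (hS : S.card = k + 1) :
    ∑ l ∈ S, (z l ^ 2)⁻¹ * ((∏ i ∈ S.erase l, shuffleKer T z i l)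
        - T ^ (k + 1) * ∏ i ∈ S.erase l, shuffleKer T z l i)
      = (1 - T) * (-1) ^ k * (∏ i ∈ S, z i ^ 2)⁻¹ := by
  have h := sum_prod_lagrange_eq_one hT0 hT1 hz (S := S) (card_pos.1 (by omega))
  have hT1' : 1 - T ≠ 0 := sub_ne_zero.2 hT1.symm
  refine Eq.trans ?_ ((congrArg (fun y => (1 - T) * (-1) ^ k * (∏ i ∈ S, z i ^ 2)⁻¹ * y) h).trans
    (mul_one _))
  rw [mul_add, mul_sum, mul_sum, ← sum_add_distrib]
  refine sum_congr rfl fun l hl => ?_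
  have hc : (S.erase l).card = k := by rw [card_erase_of_mem hl]; omega
  have hzl := hz.ne_zero l
  have e1 : ∏ i ∈ S.erase l, shuffleKer T z i l = (-1) ^ k * (∏ i ∈ S.erase l, z i ^ 2)⁻¹ *
      ((∏ i ∈ S.erase l, z i / (z i - z l)) * ∏ i ∈ S.erase l, z i / (z i - T * z l)) := by
    rw [← hc, ← prod_const, ← prod_inv_distrib, ← prod_mul_distrib, ← prod_mul_distrib,
      ← prod_mul_distrib]
    refine prod_congr rfl fun i hi => ?_
    have hne := ne_of_mem_erase hi
    have h1 := sub_ne_zero.2 (hz.ne i l hne)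
    have h2 := sub_ne_zero.2 (hz.ne_mul i l hne)
    have h3 := hz.ne_zero i
    rw [shuffleKer, show z l - z i = -(z i - z l) by ring]
    field_simp
  have e2 : T ^ k * ∏ i ∈ S.erase l, shuffleKer T z l i
      = (-1) ^ k * (∏ i ∈ S.erase l, z i ^ 2)⁻¹ *
      ((∏ i ∈ S.erase l, T * z i / (T * z i - z l)) * ∏ i ∈ S.erase l, z i / (z i - z l)) := by
    rw [← hc, ← prod_const, ← prod_const, ← prod_inv_distrib, ← prod_mul_distrib,
      ← prod_mul_distrib, ← prod_mul_distrib, ← prod_mul_distrib]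
    refine prod_congr rfl fun i hi => ?_
    have hne := ne_of_mem_erase hi
    have h1 := sub_ne_zero.2 (hz.ne i l hne)
    have h2 := sub_ne_zero.2 (hz.ne_mul l i hne.symm)
    have h3 := hz.ne_zero i
    have h4 : T * z i - z l ≠ 0 := by
      rw [show T * z i - z l = -(z l - T * z i) by ring]; exact neg_ne_zero.2 h2
    rw [shuffleKer, show z l - T * z i = -(T * z i - z l) by ring]
    field_simp
  rw [pow_succ T k, mul_comm (T ^ k), mul_assoc T, e1, e2,
    ← mul_prod_erase S (fun i => z i ^ 2) hl,
    ← mul_prod_erase S (fun i => z i / (z i - T * z l)) hl,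
    ← mul_prod_erase S (fun i => T * z i / (T * z i - z l)) hl]
  have a1 : z l / (z l - T * z l) = (1 - T)⁻¹ := by
    rw [show z l - T * z l = z l * (1 - T) by ring]; field_simp
  have a2 : T * z l / (T * z l - z l) = - T * (1 - T)⁻¹ := by
    rw [show T * z l - z l = - (z l * (1 - T)) by ring]; field_simp
  rw [a1, a2]
  field_simp
  ring

/-- One more commutator adds a variable while keeping the function a pure monomial. The shift of the
exponent by 2 matches the step between successive generators in `mIter`. -/
theorem monomialFun_commutator {T : L} (hT0 : T ≠ 0) (hT1 : T ≠ 1) {z : ι → L}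
    (hz : IsGenericFamily T z) (k : ℕ) (a : ℤ) :
    shuffleConv (shuffleKer T z) (monomialFun z k a) (monomialFun z 1 (a - 2))
      - T ^ (k + 1) • shuffleConv (shuffleKer T z) (monomialFun z 1 (a - 2)) (monomialFun z k a)
      = ((1 - T) * (-1) ^ k) • monomialFun z (k + 1) (a - 2) := by
  funext S
  simp only [Pi.sub_apply, Pi.smul_apply, smul_eq_mul]
  rw [shuffleConv_monomialFun_one, shuffleConv_monomialFun_one_right, mul_sum, ← sum_sub_distrib]
  by_cases hS : S.card = k + 1
  · rw [monomialFun, if_pos hS]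
    have hP : ∏ i ∈ S, z i ^ (a - 2) = (∏ i ∈ S, z i ^ a) * (∏ i ∈ S, z i ^ 2)⁻¹ := by
      rw [← prod_inv_distrib, ← prod_mul_distrib]
      refine prod_congr rfl fun i _ => ?_
      rw [zpow_sub₀ (hz.ne_zero i), div_eq_mul_inv]; norm_cast
    rw [hP, mul_left_comm, ← sum_shuffleKer_sub hT0 hT1 hz hS, mul_sum]
    refine sum_congr rfl fun l hl => ?_
    have hc : (S.erase l).card = k := by rw [card_erase_of_mem hl]; omega
    rw [monomialFun, if_pos hc, ← mul_prod_erase S _ hl, zpow_sub₀ (hz.ne_zero l),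
      show z l ^ (2 : ℤ) = z l ^ 2 by norm_cast]
    ring
  · rw [monomialFun, if_neg hS, mul_zero]
    refine sum_eq_zero fun l hl => ?_
    have hc : (S.erase l).card ≠ k := by
      rw [card_erase_of_mem hl]; have := card_pos.2 ⟨l, hl⟩; omega
    simp [monomialFun, hc]

end CommutatorIdentity

/-! ### The elements M act as pure monomials. -/

section Representation

open Finset

variable {ι L : Type*} [DecidableEq ι] [Field L] [Algebra QField L]

theorem qFrak_ne_zero : qFrak ≠ 0 := pow_ne_zero 2 RatFunc.X_ne_zero

theorem qFrak_pow_ne_one {n : ℕ} (hn : n ≠ 0) : qFrak ^ n ≠ 1 := by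
  intro h
  have h2 : (algebraMap (Polynomial ℂ) QField) (Polynomial.X ^ (2 * n))
      = algebraMap (Polynomial ℂ) QField 1 := by
    rw [map_pow, map_one, RatFunc.algebraMap_X, pow_mul]; exact h
  have h3 := congrArg Polynomial.natDegree (RatFunc.algebraMap_injective ℂ h2)
  rw [Polynomial.natDegree_X_pow, Polynomial.natDegree_one] at h3
  omega

theorem shuffleRep_mIter (z : ι → L) (hz : IsGenericFamily (algebraMap QField L qFrak) z)
    (m : ℤ) (j : ℕ) :
    shuffleRep z hz (mIter m j) = ((1 - qFrak) ^ j * (-1) ^ ((j + 1) * j / 2)) •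
      shuffleEnd (shuffleKer (algebraMap QField L qFrak) z)
        (monomialFun z (j + 1) (-m - 2 * j)) := by
  have inj := (algebraMap QField L).injective
  induction j with
  | zero => simp [mIter, mOne, shuffleRep_eGen]
  | succ j ih =>
    have hT0 : algebraMap QField L qFrak ≠ 0 := by
      rw [← map_zero (algebraMap QField L)]; exact inj.ne qFrak_ne_zero
    have hT1 : algebraMap QField L qFrak ≠ 1 := by
      rw [← map_one (algebraMap QField L)]
      exact inj.ne (by simpa using qFrak_pow_ne_one one_ne_zero)
    have h := monomialFun_commutator hT0 hT1 hz (j + 1) (-m - 2 * j)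
    -- The signs from the successive commutators accumulate with exponent 1 + 2 + ⋯ + (j + 1), a
    -- triangular number.
    have hsgn : (-1 : QField) ^ ((j + 1 + 1) * (j + 1) / 2)
        = (-1) ^ ((j + 1) * j / 2) * (-1) ^ (j + 1) := by
      rw [← pow_add]
      congr 1
      rw [show (j + 1 + 1) * (j + 1) = (j + 1) * j + (j + 1) * 2 by ring,
        Nat.add_mul_div_right _ _ (by norm_num)]
    have hexp : -(m + 2 * ((j : ℤ) + 1)) = -m - 2 * j - 2 := by ring
    have hexp' : -m - 2 * ((j + 1 : ℕ) : ℤ) = -m - 2 * j - 2 := by push_cast; ring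
    rw [mIter, xComm, map_sub, map_smul, map_mul, map_mul, ih, mOne, shuffleRep_eGen, hexp, hexp',
      smul_mul_assoc, mul_smul_comm, smul_comm (qFrak ^ _), shuffleEnd_mul,
      shuffleEnd_mul, ← shuffleEnd_smul, ← shuffleEnd_smul, ← shuffleEnd_smul, ← shuffleEnd_sub,
      ← smul_sub]
    have h' : shuffleConv (shuffleKer (algebraMap QField L qFrak) z)
          (monomialFun z (j + 1) (-m - 2 * j)) (monomialFun z 1 (-m - 2 * j - 2))
        - qFrak ^ (j + 2) • shuffleConv (shuffleKer (algebraMap QField L qFrak) z)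
          (monomialFun z 1 (-m - 2 * j - 2)) (monomialFun z (j + 1) (-m - 2 * j))
        = ((1 - qFrak) * (-1) ^ (j + 1)) • monomialFun z (j + 1 + 1) (-m - 2 * j - 2) := by
      funext S
      have hS := congrFun h S
      simp only [Pi.sub_apply, Pi.smul_apply, smul_eq_mul] at hS ⊢
      simp only [Algebra.smul_def, map_mul, map_pow, map_sub, map_neg, map_one]
      exact hS
    rw [h', smul_smul, shuffleEnd_smul, hsgn]
    congr 1
    ring

theorem shuffleRep_mElt (z : ι → L) (hz : IsGenericFamily (algebraMap QField L qFrak) z)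
    (k : ℕ) (n : ℤ) :
    shuffleRep z hz (mElt k n) = shuffleEnd (shuffleKer (algebraMap QField L qFrak) z)
        (monomialFun z k (-n - k + 1)) := by
  cases k with
  | zero =>
    -- With no variables the exponent is immaterial: the monomial is the indicator of the empty set,
    -- the unit for the shuffle product.
    rw [mElt, map_one]
    ext F S
    rw [shuffleEnd_apply, shuffleConv, sum_eq_single ∅]
    · simp [monomialFun, crossProd]
    · intro I _ hI
      simp [monomialFun, hI]
    · simp
  | succ k =>
    have h1 : (1 - qFrak) ^ k ≠ 0 :=
      pow_ne_zero _ (sub_ne_zero.2 (by simpa using (qFrak_pow_ne_one one_ne_zero).symm))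
    have hs : ((-1 : QField) ^ ((k + 1) * k / 2)) * (-1) ^ ((k + 1) * k / 2) = 1 := by
      rw [← mul_pow]; simp
    rw [mElt, map_smul, shuffleRep_mIter, smul_smul]
    -- The normalising constant of M is exactly the inverse of the scalar produced by the iterated
    -- commutator.
    have hc : (-1 : QField) ^ ((k + 1) * k / 2) / (1 - qFrak) ^ k *
        ((1 - qFrak) ^ k * (-1) ^ ((k + 1) * k / 2)) = 1 := by
      rw [div_mul_eq_mul_div, mul_left_comm, hs, mul_one, div_self h1]
    rw [hc, one_smul]
    congr 2
    push_cast; ring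

end Representation

/-! ### The subset sum as a polynomial in one variable, and its special values. -/

section SubsetIdentity

open Finset

variable {ι L : Type*} [DecidableEq ι] [Field L]

/-- The weighted sum `∑_{I ⊆ S} (A |I| + B |I| z_{S \ I} / z_I) ∏_{i ∈ I, j ∈ S \ I} w i j`. -/
def weightedSubsetSum (T : L) (z : ι → L) (A B : ℕ → L) (S : Finset ι) : L :=
  ∑ I ∈ S.powerset, crossProd (shuffleKer T z) I (S \ I) *
    (A I.card + B I.card * ((∏ j ∈ S \ I, z j) / ∏ i ∈ I, z i))

/-- The summand of `clearedPoly` indexed by `I`, without its weight. -/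
noncomputable def clearedTerm (T : L) (z : ι → L) (a b a' b' : L) (I J : Finset ι) :
    Polynomial L :=
  (Polynomial.C a * Polynomial.X + Polynomial.C b) * (∏ j ∈ J, Polynomial.C (-1 : L) *
      (Polynomial.C (z j) - Polynomial.C T * Polynomial.X)) *
      (∏ i ∈ I, (Polynomial.X - Polynomial.C (z i)) * ((Polynomial.X - Polynomial.C (T * z i)) *
        (Polynomial.C (z i) - Polynomial.C T * Polynomial.X))) +
    (Polynomial.C a' * Polynomial.X + Polynomial.C b' * Polynomial.X ^ 2) *
      (∏ i ∈ I, (Polynomial.X - Polynomial.C (T * z i))) *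
      (∏ j ∈ J, (Polynomial.X - Polynomial.C (z j)) * ((Polynomial.X - Polynomial.C (T * z j)) *
        (Polynomial.C (z j) - Polynomial.C T * Polynomial.X)))

/-- The sum `weightedSubsetSum` over `S` and one more variable `X`, multiplied by
`X ∏_{s ∈ S} (X - z_s) (X - T z_s) (z_s - T X)`. -/
noncomputable def clearedPoly (T : L) (z : ι → L) (A B : ℕ → L) (S : Finset ι) : Polynomial L :=
  ∑ I ∈ S.powerset, Polynomial.C (crossProd (shuffleKer T z) I (S \ I)) *
    clearedTerm T z (A (I.card + 1)) (B (I.card + 1) * ((∏ j ∈ S \ I, z j) / ∏ i ∈ I, z i))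
      (A I.card) (B I.card * ((∏ j ∈ S \ I, z j) / ∏ i ∈ I, z i)) I (S \ I)

omit [DecidableEq ι] in
theorem eval_clearedTerm (T : L) (z : ι → L) (a b a' b' : L) (I J : Finset ι) (x : L) :
    (clearedTerm T z a b a' b' I J).eval x =
      (a * x + b) * (∏ j ∈ J, -1 * (z j - T * x)) *
        (∏ i ∈ I, (x - z i) * ((x - T * z i) * (z i - T * x))) +
      (a' * x + b' * x ^ 2) * (∏ i ∈ I, (x - T * z i)) *
        (∏ j ∈ J, (x - z j) * ((x - T * z j) * (z j - T * x))) := by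
  simp only [clearedTerm, Polynomial.eval_add, Polynomial.eval_mul, Polynomial.eval_prod,
    Polynomial.eval_sub, Polynomial.eval_C, Polynomial.eval_X, Polynomial.eval_pow]

theorem eval_clearedPoly (T : L) (z : ι → L) (A B : ℕ → L) (S : Finset ι) (x : L) :
    (clearedPoly T z A B S).eval x = ∑ I ∈ S.powerset, crossProd (shuffleKer T z) I (S \ I) *
      (clearedTerm T z (A (I.card + 1)) (B (I.card + 1) * ((∏ j ∈ S \ I, z j) / ∏ i ∈ I, z i))
        (A I.card) (B I.card * ((∏ j ∈ S \ I, z j) / ∏ i ∈ I, z i)) I (S \ I)).eval x := by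
  simp only [clearedPoly, Polynomial.eval_finsetSum, Polynomial.eval_mul, Polynomial.eval_C]

theorem sum_powerset_insert_sdiff {M : Type*} [AddCommMonoid M] {S : Finset ι} {k : ι}
    (hk : k ∉ S) (f : Finset ι → Finset ι → M) :
    ∑ I ∈ (insert k S).powerset, f I (insert k S \ I) =
      ∑ I ∈ S.powerset, (f I (insert k (S \ I)) + f (insert k I) (S \ I)) := by
  rw [sum_powerset_insert hk, ← sum_add_distrib]
  refine sum_congr rfl fun I hI => ?_
  have hkI : k ∉ I := fun h => hk (mem_powerset.1 hI h)
  rw [insert_sdiff_of_notMem _ hkI]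
  congr 2
  ext x; simp only [mem_sdiff, mem_insert]; grind

omit [DecidableEq ι] in
theorem prod_shuffleKer_left_cancel {T : L} {z : ι → L} (hz : IsGenericFamily T z) {k : ι}
    {J : Finset ι} (hk : k ∉ J) :
    (∏ j ∈ J, shuffleKer T z k j) * ∏ j ∈ J, (z k - z j) * ((z k - T * z j) * (z j - T * z k))
      = ∏ j ∈ J, -1 * (z j - T * z k) := by
  rw [← prod_mul_distrib]
  refine prod_congr rfl fun j hj => ?_
  have hne : k ≠ j := fun h => hk (h ▸ hj)
  have k1 := inv_mul_cancel₀ (sub_ne_zero.2 (hz.ne _ _ hne.symm))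
  have k2 := inv_mul_cancel₀ (sub_ne_zero.2 (hz.ne_mul _ _ hne))
  rw [shuffleKer, mul_inv]
  linear_combination (-(z j - T * z k)) * (k1 * ((z k - T * z j)⁻¹ * (z k - T * z j)) + k2)

omit [DecidableEq ι] in
theorem prod_shuffleKer_right_cancel {T : L} {z : ι → L} (hz : IsGenericFamily T z) {k : ι}
    {I : Finset ι} (hk : k ∉ I) :
    (∏ i ∈ I, shuffleKer T z i k) * ∏ i ∈ I, (z k - z i) * ((z k - T * z i) * (z i - T * z k))
      = ∏ i ∈ I, (z k - T * z i) := by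
  rw [← prod_mul_distrib]
  refine prod_congr rfl fun i hi => ?_
  have hne : k ≠ i := fun h => hk (h ▸ hi)
  have k1 := inv_mul_cancel₀ (sub_ne_zero.2 (hz.ne _ _ hne))
  have k2 := inv_mul_cancel₀ (sub_ne_zero.2 (hz.ne_mul _ _ hne.symm))
  rw [shuffleKer, mul_inv]
  linear_combination (z k - T * z i) * (k1 * ((z i - T * z k)⁻¹ * (z i - T * z k)) + k2)

/-- The two halves of `clearedTerm` correspond to the new variable lying in I or in its complement.
The poles are simple, so one copy of each linear factor clears both kernels; the additional factor X
clears the ratio when X lies in I. -/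
theorem eval_clearedPoly_eq {T : L} {z : ι → L} (hz : IsGenericFamily T z) (A B : ℕ → L)
    {S : Finset ι} {k : ι} (hk : k ∉ S) :
    (clearedPoly T z A B S).eval (z k) = weightedSubsetSum T z A B (insert k S) *
      (z k * ∏ s ∈ S, (z k - z s) * ((z k - T * z s) * (z s - T * z k))) := by
  rw [eval_clearedPoly, weightedSubsetSum, sum_powerset_insert_sdiff hk (fun I J =>
    crossProd (shuffleKer T z) I J * (A I.card + B I.card * ((∏ j ∈ J, z j) / ∏ i ∈ I, z i))),
    sum_mul]
  refine sum_congr rfl fun I hI => ?_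
  have hIS := mem_powerset.1 hI
  have hkI : k ∉ I := fun h => hk (hIS h)
  have hkJ : k ∉ S \ I := fun h => hk (mem_sdiff.1 h).1
  have hzk := hz.ne_zero k
  have hzI : ∏ i ∈ I, z i ≠ 0 := prod_ne_zero_iff.2 fun i _ => hz.ne_zero i
  rw [eval_clearedTerm, crossProd_insert_left _ hkI, crossProd_insert_right _ hkJ,
    card_insert_of_notMem hkI, prod_insert hkI, prod_insert hkJ, ← prod_sdiff hIS]
  have e1 := prod_shuffleKer_left_cancel hz hkJ
  have e2 := prod_shuffleKer_right_cancel hz hkI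
  rw [← e1, ← e2]
  have e3 : (z k * ∏ j ∈ S \ I, z j) / ∏ i ∈ I, z i = z k * ((∏ j ∈ S \ I, z j) / ∏ i ∈ I, z i) := by
    ring
  have e4 : (∏ j ∈ S \ I, z j) / (z k * ∏ i ∈ I, z i)
      = (z k)⁻¹ * ((∏ j ∈ S \ I, z j) / ∏ i ∈ I, z i) := by
    field_simp
  rw [e3, e4]
  have e5 : z k * (z k)⁻¹ = 1 := mul_inv_cancel₀ hzk
  linear_combination (- crossProd (shuffleKer T z) I (S \ I) * B (I.card + 1) *
    ((∏ j ∈ S \ I, z j) / ∏ i ∈ I, z i) * (∏ j ∈ S \ I, shuffleKer T z k j) *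
      (∏ j ∈ S \ I, (z k - z j) * ((z k - T * z j) * (z j - T * z k))) *
      (∏ j ∈ I, (z k - z j) * ((z k - T * z j) * (z j - T * z k)))) * e5

/-- At X = z_y only the configurations separating X from y survive. Exchanging the two pairs them
off with opposite signs, since the kernel has opposite residues on the diagonal; this holds for any
weights. -/
theorem eval_clearedPoly_self {T : L} {z : ι → L} (hz : IsGenericFamily T z) (A B : ℕ → L)
    {S : Finset ι} {y : ι} (hy : y ∉ S) :
    (clearedPoly T z A B (insert y S)).eval (z y) = 0 := by
  rw [eval_clearedPoly, sum_powerset_insert_sdiff hy (fun I J =>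
    crossProd (shuffleKer T z) I J * (clearedTerm T z (A (I.card + 1))
      (B (I.card + 1) * ((∏ j ∈ J, z j) / ∏ i ∈ I, z i)) (A I.card)
      (B I.card * ((∏ j ∈ J, z j) / ∏ i ∈ I, z i)) I J).eval (z y))]
  refine sum_eq_zero fun I hI => ?_
  have hIS := mem_powerset.1 hI
  have hyI : y ∉ I := fun h => hy (hIS h)
  have hyJ : y ∉ S \ I := fun h => hy (mem_sdiff.1 h).1
  have hzy := hz.ne_zero y
  have hzI : ∏ i ∈ I, z i ≠ 0 := prod_ne_zero_iff.2 fun i _ => hz.ne_zero i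
  rw [eval_clearedTerm, eval_clearedTerm, crossProd_insert_left _ hyI, crossProd_insert_right _ hyJ,
    card_insert_of_notMem hyI]
  simp only [prod_insert hyI, prod_insert hyJ, sub_self, zero_mul, mul_zero, add_zero, zero_add]
  have e1 := prod_shuffleKer_left_cancel hz hyJ
  have e2 := prod_shuffleKer_right_cancel hz hyI
  rw [← e1, ← e2]
  have e3 : (z y * ∏ j ∈ S \ I, z j) / ∏ i ∈ I, z i = z y * ((∏ j ∈ S \ I, z j) / ∏ i ∈ I, z i) := by
    ring
  have e4 : (∏ j ∈ S \ I, z j) / (z y * ∏ i ∈ I, z i)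
      = (z y)⁻¹ * ((∏ j ∈ S \ I, z j) / ∏ i ∈ I, z i) := by
    field_simp
  rw [e3, e4]
  field_simp
  ring

/-- At X = T z_y the only survivors have X in I and y in the complement. The pair then contributes
z_y / X = 1 / T to the ratio, whence the relative factor T between the new weights, and the kernels
between I and the pair leave T^|I|. -/
theorem eval_clearedPoly_mul {T : L} {z : ι → L} (hz : IsGenericFamily T z) (A B : ℕ → L)
    {S : Finset ι} {y : ι} (hy : y ∉ S) :
    (clearedPoly T z A B (insert y S)).eval (T * z y) =
      - (z y * (1 - T ^ 2) * z y) * (∏ s ∈ S, -1 * (z s - T ^ 2 * z y)) *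
        weightedSubsetSum T z (fun k => T ^ k * (A (k + 1) * T)) (fun k => T ^ k * B (k + 1)) S := by
  rw [eval_clearedPoly, sum_powerset_insert_sdiff hy (fun I J =>
    crossProd (shuffleKer T z) I J * (clearedTerm T z (A (I.card + 1))
      (B (I.card + 1) * ((∏ j ∈ J, z j) / ∏ i ∈ I, z i)) (A I.card)
      (B I.card * ((∏ j ∈ J, z j) / ∏ i ∈ I, z i)) I J).eval (T * z y)), weightedSubsetSum, mul_sum]
  refine sum_congr rfl fun I hI => ?_
  have hIS := mem_powerset.1 hI
  have hyI : y ∉ I := fun h => hy (hIS h)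
  have hyJ : y ∉ S \ I := fun h => hy (mem_sdiff.1 h).1
  have hne : ∀ i ∈ S, (z y - z i) ≠ 0 ∧ (z i - T * z y) ≠ 0 := by
    intro i hi
    have : y ≠ i := fun h => hy (h ▸ hi)
    exact ⟨sub_ne_zero.2 (hz.ne _ _ this), sub_ne_zero.2 (hz.ne_mul _ _ this.symm)⟩
  rw [eval_clearedTerm, eval_clearedTerm, crossProd_insert_left _ hyI, crossProd_insert_right _ hyJ]
  simp only [prod_insert hyI, prod_insert hyJ, sub_self, zero_mul, mul_zero, add_zero]
  have e2 : (∏ i ∈ I, shuffleKer T z i y) *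
      ∏ i ∈ I, (T * z y - z i) * ((T * z y - T * z i) * (z i - T * (T * z y)))
      = T ^ I.card * ∏ i ∈ I, -1 * (z i - T ^ 2 * z y) := by
    rw [← prod_const, ← prod_mul_distrib, ← prod_mul_distrib]
    refine prod_congr rfl fun j hj => ?_
    obtain ⟨h1, h2⟩ := hne j (hIS hj)
    rw [shuffleKer, mul_inv, show T * z y - z j = -(z j - T * z y) by ring]
    have k1 := inv_mul_cancel₀ h1
    have k2 := inv_mul_cancel₀ h2
    linear_combination (-T * (z j - T ^ 2 * z y)) * (k1 * ((z j - T * z y)⁻¹ * (z j - T * z y)) + k2)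
  have e3 : (z y * ∏ j ∈ S \ I, z j) / ∏ i ∈ I, z i = z y * ((∏ j ∈ S \ I, z j) / ∏ i ∈ I, z i) := by
    ring
  have e5 : ∏ j ∈ S \ I, -1 * (z j - T * (T * z y)) = ∏ j ∈ S \ I, -1 * (z j - T ^ 2 * z y) :=
    prod_congr rfl fun j _ => by ring
  rw [e3, e5, ← prod_sdiff hIS]
  linear_combination (crossProd (shuffleKer T z) I (S \ I) * ((A (I.card + 1) * (T * z y) +
    B (I.card + 1) * (z y * ((∏ j ∈ S \ I, z j) / ∏ i ∈ I, z i))) *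
    (-1 * (z y - T * (T * z y)) * ∏ j ∈ S \ I, -1 * (z j - T ^ 2 * z y)))) * e2

/-- The mirror case: at X = z_y / T the survivors have y in I and X in the complement, with the same
ratio 1 / T. The power of T on the left avoids a division by T^|S \ I|. -/
theorem eval_clearedPoly_div {T : L} (hT : T ≠ 0) {z : ι → L} (hz : IsGenericFamily T z)
    (A B : ℕ → L) {S : Finset ι} {y : ι} (hy : y ∉ S) :
    (clearedPoly T z A B (insert y S)).eval (z y / T) * T ^ S.card =
      z y / T ^ 2 * (z y / T - T * z y) * (∏ s ∈ S, (z y / T - T * z s)) *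
        weightedSubsetSum T z (fun k => T ^ k * (A (k + 1) * T)) (fun k => T ^ k * B (k + 1)) S := by
  rw [eval_clearedPoly, sum_powerset_insert_sdiff hy (fun I J =>
    crossProd (shuffleKer T z) I J * (clearedTerm T z (A (I.card + 1))
      (B (I.card + 1) * ((∏ j ∈ J, z j) / ∏ i ∈ I, z i)) (A I.card)
      (B I.card * ((∏ j ∈ J, z j) / ∏ i ∈ I, z i)) I J).eval (z y / T)), weightedSubsetSum, mul_sum, sum_mul]
  refine sum_congr rfl fun I hI => ?_
  have hIS := mem_powerset.1 hI
  have hyI : y ∉ I := fun h => hy (hIS h)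
  have hyJ : y ∉ S \ I := fun h => hy (mem_sdiff.1 h).1
  have hzy := hz.ne_zero y
  have hzI : ∏ i ∈ I, z i ≠ 0 := prod_ne_zero_iff.2 fun i _ => hz.ne_zero i
  have hne : ∀ i ∈ S, (z i - z y) ≠ 0 ∧ (z y - T * z i) ≠ 0 := by
    intro i hi
    have : y ≠ i := fun h => hy (h ▸ hi)
    exact ⟨sub_ne_zero.2 (hz.ne _ _ this.symm), sub_ne_zero.2 (hz.ne_mul _ _ this)⟩
  have hTy : T * (z y / T) = z y := by field_simp
  rw [eval_clearedTerm, eval_clearedTerm, crossProd_insert_left _ hyI, crossProd_insert_right _ hyJ]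
  simp only [prod_insert hyI, prod_insert hyJ, hTy, sub_self, zero_mul, mul_zero, add_zero, zero_add,
    card_insert_of_notMem hyI]
  have e2 : (∏ j ∈ S \ I, shuffleKer T z y j) *
      (∏ j ∈ S \ I, (z y / T - z j) * ((z y / T - T * z j) * (z j - z y))) * T ^ (S \ I).card
      = ∏ j ∈ S \ I, (z y / T - T * z j) := by
    rw [← prod_const, ← prod_mul_distrib, ← prod_mul_distrib]
    refine prod_congr rfl fun j hj => ?_
    obtain ⟨h1, h2⟩ := hne j (mem_sdiff.1 hj).1
    rw [shuffleKer, mul_inv, show z y / T - z j = (z y - T * z j) / T by field_simp]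
    have k1 := inv_mul_cancel₀ h1
    have k2 := inv_mul_cancel₀ h2
    have k3 := inv_mul_cancel₀ hT
    rw [div_eq_mul_inv, div_eq_mul_inv]
    linear_combination (z y * T⁻¹ - T * z j) *
      (k1 * ((z y - T * z j)⁻¹ * (z y - T * z j) * (T⁻¹ * T)) + k2 * (T⁻¹ * T) + k3)
  have e4 : (∏ j ∈ S \ I, z j) / (z y * ∏ i ∈ I, z i)
      = (z y)⁻¹ * ((∏ j ∈ S \ I, z j) / ∏ i ∈ I, z i) := by
    field_simp
  have e6 : T ^ S.card = T ^ (S \ I).card * T ^ I.card := by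
    rw [← pow_add, card_sdiff_add_card_eq_card hIS]
  have e7 : A (I.card + 1) * (z y / T) + B (I.card + 1) *
      ((z y)⁻¹ * ((∏ j ∈ S \ I, z j) / ∏ i ∈ I, z i)) * (z y / T) ^ 2 =
      z y / T ^ 2 * (A (I.card + 1) * T + B (I.card + 1) * ((∏ j ∈ S \ I, z j) / ∏ i ∈ I, z i)) := by
    field_simp
  rw [e4, e6, e7, ← prod_sdiff hIS, ← e2]
  ring

end SubsetIdentity

/-! ### Degree bound, induction, and the relation for monomials. -/

section SubsetIdentity

open Finset

variable {ι L : Type*} [DecidableEq ι] [Field L]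

omit [DecidableEq ι] in
theorem natDegree_clearedTerm_left_le (T : L) (z : ι → L) (p : Polynomial L) (I J : Finset ι) :
    (p * (∏ j ∈ J, Polynomial.C (-1 : L) *
      (Polynomial.C (z j) - Polynomial.C T * Polynomial.X)) *
      (∏ i ∈ I, (Polynomial.X - Polynomial.C (z i)) * ((Polynomial.X - Polynomial.C (T * z i)) *
        (Polynomial.C (z i) - Polynomial.C T * Polynomial.X)))).natDegree
      ≤ p.natDegree + J.card + 3 * I.card := by
  refine Polynomial.natDegree_mul_le.trans (add_le_add (Polynomial.natDegree_mul_le.trans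
    (add_le_add le_rfl ?_)) ?_)
  · refine (Polynomial.natDegree_prod_le _ _).trans ((sum_le_card_nsmul _ _ 1 fun j _ => ?_).trans
      (by simp))
    compute_degree
  · refine (Polynomial.natDegree_prod_le _ _).trans ((sum_le_card_nsmul _ _ 3 fun j _ => ?_).trans
      (by simp [mul_comm]))
    compute_degree

omit [DecidableEq ι] in
theorem natDegree_clearedTerm_right_le (T : L) (z : ι → L) (p : Polynomial L) (I J : Finset ι) :
    (p * (∏ i ∈ I, (Polynomial.X - Polynomial.C (T * z i))) *
      (∏ j ∈ J, (Polynomial.X - Polynomial.C (z j)) * ((Polynomial.X - Polynomial.C (T * z j)) *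
        (Polynomial.C (z j) - Polynomial.C T * Polynomial.X)))).natDegree
      ≤ p.natDegree + I.card + 3 * J.card := by
  refine Polynomial.natDegree_mul_le.trans (add_le_add (Polynomial.natDegree_mul_le.trans
    (add_le_add le_rfl ?_)) ?_)
  · refine (Polynomial.natDegree_prod_le _ _).trans ((sum_le_card_nsmul _ _ 1 fun j _ => ?_).trans
      (by simp))
    compute_degree
  · refine (Polynomial.natDegree_prod_le _ _).trans ((sum_le_card_nsmul _ _ 3 fun j _ => ?_).trans
      (by simp [mul_comm]))
    compute_degree

/-- The constant coefficients of the subset form of the `M`-system relation. -/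
def relCoeffConst (m : ℕ) (k : ℕ) : L := if k = m then 1 else 0

/-- The coefficients of the ratios in the subset form of the `M`-system relation. -/
def relCoeffRatio (T : L) (m : ℕ) (k : ℕ) : L :=
  if k = m then -T ^ m else if k = m + 1 then -1 else 0

theorem natDegree_clearedPoly_le (T : L) (z : ι → L) (m : ℕ) {S : Finset ι}
    (hS : S.card = 2 * m + 1) :
    (clearedPoly T z (relCoeffConst (m + 1)) (relCoeffRatio T (m + 1)) S).natDegree
      ≤ 4 * m + 3 := by
  refine Polynomial.natDegree_sum_le_of_forall_le _ _ fun I hI => ?_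
  refine Polynomial.natDegree_C_mul_le _ _ |>.trans ?_
  have hc : (S \ I).card + I.card = 2 * m + 1 := by
    rw [card_sdiff_add_card_eq_card (mem_powerset.1 hI), hS]
  refine Polynomial.natDegree_add_le_of_degree_le ?_ ?_
  -- The weights are supported on two adjacent cardinalities near the middle, so the cubic factors
  -- range over about half of `S`. Arbitrary weights could give degree close to 3|S|, too much for
  -- the zero count.
  · by_cases h1 : I.card = m
    · refine (natDegree_clearedTerm_left_le _ _ _ _ _).trans ?_
      have : ∀ a b : L, (Polynomial.C a * Polynomial.X + Polynomial.C b).natDegree ≤ 1 :=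
        fun a b => by compute_degree
      have := this (relCoeffConst (m + 1) (I.card + 1)) (relCoeffRatio T (m + 1) (I.card + 1) *
        ((∏ j ∈ S \ I, z j) / ∏ i ∈ I, z i))
      omega
    · have e : (relCoeffConst (m + 1) (I.card + 1) : L) = 0 := by simp [relCoeffConst, h1]
      by_cases h2 : I.card = m + 1
      · refine (natDegree_clearedTerm_left_le _ _ _ _ _).trans ?_
        rw [e, map_zero, zero_mul, zero_add, Polynomial.natDegree_C]
        omega
      · have e' : relCoeffRatio T (m + 1) (I.card + 1) = 0 := by simp [relCoeffRatio, h1, h2]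
        simp [e, e']
  · by_cases h1 : I.card = m + 1 ∨ I.card = m + 2
    · refine (natDegree_clearedTerm_right_le _ _ _ _ _).trans ?_
      have : ∀ a b : L, (Polynomial.C a * Polynomial.X + Polynomial.C b *
          Polynomial.X ^ 2).natDegree ≤ 2 := fun a b => by compute_degree!
      have := this (relCoeffConst (m + 1) I.card) (relCoeffRatio T (m + 1) I.card *
        ((∏ j ∈ S \ I, z j) / ∏ i ∈ I, z i))
      omega
    · push Not at h1
      have e : (relCoeffConst (m + 1) I.card : L) = 0 := by simp [relCoeffConst, h1]
      have e' : relCoeffRatio T (m + 1) I.card = 0 := by simp [relCoeffRatio, h1]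
      simp [e, e']

/-- The weights left by the special values at T z_y and z_y / T are those of the relation one step
lower, up to a scalar, so the induction closes. -/
theorem weightedSubsetSum_relCoeff_shift (T : L) (z : ι → L) (m : ℕ) (S : Finset ι) :
    weightedSubsetSum T z (fun k => T ^ k * (relCoeffConst (m + 1) (k + 1) * T))
        (fun k => T ^ k * relCoeffRatio T (m + 1) (k + 1)) S
      = T ^ (m + 1) * weightedSubsetSum T z (relCoeffConst m) (relCoeffRatio T m) S := by
  rw [weightedSubsetSum, weightedSubsetSum, mul_sum]
  refine sum_congr rfl fun I _ => ?_
  have e1 : T ^ I.card * (relCoeffConst (m + 1) (I.card + 1) * T)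
      = T ^ (m + 1) * relCoeffConst m I.card := by
    by_cases h : I.card = m <;> simp [relCoeffConst, h, pow_succ]
  have e2 : T ^ I.card * relCoeffRatio T (m + 1) (I.card + 1)
      = T ^ (m + 1) * relCoeffRatio T m I.card := by
    by_cases h : I.card = m
    · simp [relCoeffRatio, h, pow_succ]; ring
    · by_cases h' : I.card = m + 1 <;> simp [relCoeffRatio, h, h']
  rw [e1, e2]
  ring

/-- The base case needs a direct computation: with two variables the cleared polynomial has degree
bound 3 and only 3 known zeros. -/
theorem weightedSubsetSum_pair {T : L} {z : ι → L} (hz : IsGenericFamily T z) {a b : ι}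
    (hab : a ≠ b) :
    weightedSubsetSum T z (relCoeffConst 1) (relCoeffRatio T 1) {a, b} = 0 := by
  have hb : ∀ f : Finset ι → Finset ι → L, ∑ I ∈ ({b} : Finset ι).powerset, f I ({b} \ I)
      = f ∅ {b} + f {b} ∅ := fun f => by
    have h := sum_powerset_insert_sdiff (notMem_empty b) f
    simpa using h
  rw [weightedSubsetSum, sum_powerset_insert_sdiff (by simpa using hab) (fun I J =>
    crossProd (shuffleKer T z) I J * (relCoeffConst 1 I.card + relCoeffRatio T 1 I.card *
      ((∏ j ∈ J, z j) / ∏ i ∈ I, z i))), hb (fun I J =>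
    crossProd (shuffleKer T z) I (insert a J) * (relCoeffConst 1 I.card + relCoeffRatio T 1 I.card *
      ((∏ j ∈ insert a J, z j) / ∏ i ∈ I, z i)) +
    crossProd (shuffleKer T z) (insert a I) J * (relCoeffConst 1 (insert a I).card +
      relCoeffRatio T 1 (insert a I).card * ((∏ j ∈ J, z j) / ∏ i ∈ insert a I, z i)))]
  have h1 := sub_ne_zero.2 (hz.ne a b hab)
  have h2 := sub_ne_zero.2 (hz.ne_mul a b hab)
  have h3 := sub_ne_zero.2 (hz.ne_mul b a hab.symm)
  have ha0 := hz.ne_zero a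
  have hb0 := hz.ne_zero b
  simp [crossProd, relCoeffConst, relCoeffRatio, shuffleKer, card_pair hab, prod_pair hab]
  rw [show z b - z a = -(z a - z b) by ring]
  have e1 : (z a - T * z b)⁻¹ * (1 + -(T * (z b / z a))) = (z a)⁻¹ := by
    rw [show 1 + -(T * (z b / z a)) = (z a - T * z b) * (z a)⁻¹ by field_simp; ring,
      inv_mul_cancel_left₀ h2]
  have e2 : (z b - T * z a)⁻¹ * (1 + -(T * (z a / z b))) = (z b)⁻¹ := by
    rw [show 1 + -(T * (z a / z b)) = (z b - T * z a) * (z b)⁻¹ by field_simp; ring,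
      inv_mul_cancel_left₀ h3]
  have e3 : (z b)⁻¹ - (z a)⁻¹ = (z a - z b) * ((z b)⁻¹ * (z a)⁻¹) := by field_simp
  rw [inv_neg]
  linear_combination (-(z a - z b)⁻¹) * e1 + (z a - z b)⁻¹ * e2 + (z a - z b)⁻¹ * e3 +
    ((z b)⁻¹ * (z a)⁻¹) * inv_mul_cancel₀ h1

theorem weightedSubsetSum_relCoeff_eq_zero {T : L} (hT : T ≠ 0) (hT1 : T ≠ 1) (hT2 : T ^ 2 ≠ 1)
    {z : ι → L} (hz : IsGenericFamily T z) (m : ℕ) {S : Finset ι} (hS : S.card = 2 * (m + 1)) :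
    weightedSubsetSum T z (relCoeffConst (m + 1)) (relCoeffRatio T (m + 1)) S = 0 := by
  induction m generalizing S with
  | zero =>
    obtain ⟨a, b, hab, rfl⟩ := card_eq_two.1 hS
    exact weightedSubsetSum_pair hz hab
  | succ m ih =>
    obtain ⟨k, hk⟩ : S.Nonempty := card_pos.1 (by omega)
    obtain ⟨S, hkS, rfl⟩ : ∃ S', k ∉ S' ∧ S = insert k S' :=
      ⟨S.erase k, notMem_erase k S, (insert_erase hk).symm⟩
    rw [card_insert_of_notMem hkS] at hS
    -- Here |S| = 2m + 3, so the three families of zeros give 6m + 9 points against degree at most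
    -- 4m + 7. Their distinctness is where T² ≠ 1 and ratios different from T² enter: T z_i must
    -- differ from z_j / T.
    have hP : clearedPoly T z (relCoeffConst (m + 1 + 1)) (relCoeffRatio T (m + 1 + 1)) S = 0 := by
      refine Polynomial.eq_zero_of_natDegree_lt_card_of_eval_eq_zero _ (ι := S ⊕ S ⊕ S)
        (f := Sum.elim (fun s => z s) (Sum.elim (fun s => T * z s) fun s => z s / T)) ?_ ?_ ?_
      · have h1 : ∀ i j : S, z i ≠ T * z j := fun i j h => by
          by_cases hij : i = j
          · subst hij
            exact hT1 (mul_right_cancel₀ (hz.ne_zero i) (h.symm.trans (one_mul _).symm))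
          · exact hz.ne_mul i j (fun h => hij (Subtype.ext h)) h
        have h2 : ∀ i j : S, z i ≠ T ^ 2 * z j := fun i j h => by
          by_cases hij : i = j
          · subst hij
            exact hT2 (mul_right_cancel₀ (hz.ne_zero i) (h.symm.trans (one_mul _).symm))
          · exact hz.ne_sq_mul i j (fun h => hij (Subtype.ext h)) h
        have h0 : ∀ i j : S, z i = z j → i = j := fun i j h => by
          by_contra hij
          exact hz.ne i j (fun h => hij (Subtype.ext h)) h
        rintro (i | i | i) (j | j | j) h <;>
          simp only [Sum.elim_inl, Sum.elim_inr] at h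
        · rw [h0 i j h]
        · exact absurd h (h1 i j)
        · rw [eq_div_iff hT, mul_comm] at h; exact absurd h.symm (h1 j i)
        · exact absurd h.symm (h1 j i)
        · rw [h0 i j (mul_left_cancel₀ hT h)]
        · rw [eq_div_iff hT] at h; exact absurd (by rw [← h]; ring) (h2 j i)
        · rw [div_eq_iff hT, mul_comm] at h; exact absurd h (h1 i j)
        · rw [div_eq_iff hT] at h; exact absurd (by rw [h]; ring) (h2 i j)
        · rw [h0 i j (by field_simp at h; exact h)]
      · have key : ∀ s ∈ S, ∃ S', s ∉ S' ∧ S = insert s S' ∧ S'.card = 2 * (m + 1) :=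
          fun s hs => ⟨S.erase s, notMem_erase s S, (insert_erase hs).symm, by
            rw [card_erase_of_mem hs]; omega⟩
        rintro (⟨s, hs⟩ | ⟨s, hs⟩ | ⟨s, hs⟩) <;> obtain ⟨S', hsS', hSS', hcard⟩ := key s hs <;>
          simp only [Sum.elim_inl, Sum.elim_inr] <;> rw [hSS']
        · exact eval_clearedPoly_self hz _ _ hsS'
        · rw [eval_clearedPoly_mul hz _ _ hsS', weightedSubsetSum_relCoeff_shift, ih hcard,
            mul_zero, mul_zero]
        · refine mul_right_cancel₀ (pow_ne_zero S'.card hT) ?_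
          rw [eval_clearedPoly_div hT hz _ _ hsS', weightedSubsetSum_relCoeff_shift, ih hcard,
            mul_zero, mul_zero, zero_mul]
      · have := natDegree_clearedPoly_le T z (m + 1) (S := S) (by omega)
        simp only [Fintype.card_sum, Fintype.card_coe]
        omega
    have h := eval_clearedPoly_eq hz (relCoeffConst (m + 1 + 1)) (relCoeffRatio T (m + 1 + 1)) hkS
    rw [hP, Polynomial.eval_zero] at h
    refine (mul_eq_zero.1 h.symm).resolve_right (mul_ne_zero (hz.ne_zero k)
      (prod_ne_zero_iff.2 fun s hs => ?_))
    have hks : k ≠ s := fun h => hkS (h ▸ hs)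
    exact mul_ne_zero (sub_ne_zero.2 (hz.ne _ _ hks)) (mul_ne_zero
      (sub_ne_zero.2 (hz.ne_mul _ _ hks)) (sub_ne_zero.2 (hz.ne_mul _ _ hks.symm)))

/-- Factoring ∏ z_i ^ a out of each summand leaves 1, or the ratio of the product over S \ I to the
product over I, with exactly the weights `relCoeffConst` and `relCoeffRatio`. -/
theorem monomialFun_relation {T : L} (hT : T ≠ 0) (hT1 : T ≠ 1) (hT2 : T ^ 2 ≠ 1)
    {z : ι → L} (hz : IsGenericFamily T z) (m : ℕ) (a : ℤ) :
    shuffleConv (shuffleKer T z) (monomialFun z (m + 1) a) (monomialFun z (m + 1) a)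
      - T ^ (m + 1) • shuffleConv (shuffleKer T z) (monomialFun z (m + 1) (a - 1))
          (monomialFun z (m + 1) (a + 1))
      = shuffleConv (shuffleKer T z) (monomialFun z (m + 2) (a - 1))
          (monomialFun z m (a + 1)) := by
  funext S
  rw [← sub_eq_zero]
  simp only [Pi.sub_apply, Pi.smul_apply, smul_eq_mul, shuffleConv, mul_sum, ← sum_sub_distrib]
  by_cases hS : S.card = 2 * (m + 1)
  · rw [← mul_zero (∏ i ∈ S, z i ^ a), ← weightedSubsetSum_relCoeff_eq_zero hT hT1 hT2 hz m hS,
      weightedSubsetSum, mul_sum]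
    refine sum_congr rfl fun I hI => ?_
    have hc : (S \ I).card + I.card = 2 * (m + 1) := by
      rw [card_sdiff_add_card_eq_card (mem_powerset.1 hI), hS]
    have hzI : ∏ i ∈ I, z i ≠ 0 := prod_ne_zero_iff.2 fun i _ => hz.ne_zero i
    have hsub : ∀ K : Finset ι, ∏ i ∈ K, z i ^ (a - 1) = (∏ i ∈ K, z i ^ a) * (∏ i ∈ K, z i)⁻¹ := by
      intro K
      rw [← prod_inv_distrib, ← prod_mul_distrib]
      exact prod_congr rfl fun i _ => zpow_sub_one₀ (hz.ne_zero i) a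
    have hadd : ∀ K : Finset ι, ∏ i ∈ K, z i ^ (a + 1) = (∏ i ∈ K, z i ^ a) * ∏ i ∈ K, z i := by
      intro K
      rw [← prod_mul_distrib]
      exact prod_congr rfl fun i _ => zpow_add_one₀ (hz.ne_zero i) a
    rw [← prod_sdiff (mem_powerset.1 hI)]
    by_cases h1 : I.card = m + 1
    · have h2 : (S \ I).card = m + 1 := by omega
      simp only [monomialFun, h1, h2, relCoeffConst, relCoeffRatio, if_true, hsub, hadd]
      simp
      ring
    · by_cases h3 : I.card = m + 2
      · have h2 : (S \ I).card = m := by omega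
        simp only [monomialFun, h2, h3, relCoeffConst, relCoeffRatio, if_true, hsub, hadd]
        simp
        ring
      · simp [monomialFun, h1, h3, relCoeffConst, relCoeffRatio]
  · refine sum_eq_zero fun I hI => ?_
    have hc : (S \ I).card + I.card ≠ 2 * (m + 1) := by
      rwa [card_sdiff_add_card_eq_card (mem_powerset.1 hI)]
    have h1 : ¬ (I.card = m + 1 ∧ (S \ I).card = m + 1) := by omega
    have h2 : ¬ (I.card = m + 2 ∧ (S \ I).card = m) := by omega
    simp only [monomialFun]
    by_cases h3 : I.card = m + 1 <;> by_cases h4 : (S \ I).card = m + 1 <;>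
      by_cases h5 : I.card = m + 2 <;> by_cases h6 : (S \ I).card = m <;> simp_all

end SubsetIdentity

/-! ### Weakly decreasing monomials span each degree. -/

section Spanning

/-- The monomial `e_{r₁} ⋯ e_{rₖ}` attached to a list of indices. -/
noncomputable def eMonomial (l : List ℤ) : UPos := (l.map eGen).prod

theorem eMonomial_cons (r : ℤ) (l : List ℤ) : eMonomial (r :: l) = eGen r * eMonomial l := by
  simp [eMonomial]

theorem eGen_quadratic (a b : ℤ) :
    eGen (a + 1) * eGen b - qFrak • (eGen a * eGen (b + 1))
      = qFrak • (eGen b * eGen (a + 1)) - eGen (b + 1) * eGen a := by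
  have h : UPos.mk _ = UPos.mk _ := RingQuot.mkAlgHom_rel QField (UPosRel.quadratic a b)
  simp only [map_sub, map_smul, map_mul] at h
  exact h

theorem eGen_mul_eGen_of_lt (a b : ℤ) :
    eGen b * eGen (a + 1) = qFrak⁻¹ • (eGen (a + 1) * eGen b) - eGen a * eGen (b + 1)
      + qFrak⁻¹ • (eGen (b + 1) * eGen a) := by
  have h := congrArg (fun x => qFrak⁻¹ • x) (eGen_quadratic a b)
  simp only [smul_sub, inv_smul_smul₀ qFrak_ne_zero] at h
  rw [sub_eq_iff_eq_add] at h
  rw [h]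
  abel

/-- For adjacent indices the middle term of the straightening rule is the product being rewritten;
collecting it on the left gives a factor 2, which is invertible. -/
theorem eGen_mul_eGen_succ (b : ℤ) :
    eGen b * eGen (b + 1) = qFrak⁻¹ • (eGen (b + 1) * eGen b) := by
  have h := eGen_mul_eGen_of_lt b b
  have h2 : (2 : QField) • (eGen b * eGen (b + 1))
      = (2 : QField) • (qFrak⁻¹ • (eGen (b + 1) * eGen b)) := by
    rw [two_smul, two_smul]
    nth_rw 1 [h]
    abel
  have h3 := congrArg (fun x => (2 : QField)⁻¹ • x) h2
  simpa only [inv_smul_smul₀ (two_ne_zero' QField)] using h3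

/-- Weakly decreasing lists of length `N` with entries at most `m`. -/
def decreasingLists (N : ℕ) (m : ℤ) : Set (List ℤ) :=
  {l | l.length = N ∧ l.Pairwise (· ≥ ·) ∧ ∀ r ∈ l, r ≤ m}

/-- Straightening an increasing pair e_r e_s produces only products whose first index exceeds r,
with all indices still at most `m`. Hence m - r strictly decreases, which is why the spanning lists
carry an upper bound. -/
theorem eGen_mul_mem_span (N : ℕ) (m : ℤ)
    (ih : ∀ r ≤ m, ∀ x ∈ Submodule.span QField (eMonomial '' decreasingLists N m),
      eGen r * x ∈ Submodule.span QField (eMonomial '' decreasingLists (N + 1) m))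
    (r : ℤ) (hr : r ≤ m) :
    ∀ x ∈ Submodule.span QField (eMonomial '' decreasingLists (N + 1) m),
      eGen r * x ∈ Submodule.span QField (eMonomial '' decreasingLists (N + 2) m) := by
  obtain ⟨d, hd⟩ : ∃ d : ℕ, (m - r).toNat = d := ⟨_, rfl⟩
  induction d using Nat.strong_induction_on generalizing r with
  | _ d ihd =>
  intro x hx
  induction hx using Submodule.span_induction with
  | zero => simp
  | add x y _ _ hx hy => rw [mul_add]; exact add_mem hx hy
  | smul c x _ hx => rw [mul_smul_comm]; exact Submodule.smul_mem _ _ hx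
  | mem x hx =>
    obtain ⟨l, ⟨hl, hs, hm⟩, rfl⟩ := hx
    obtain ⟨s, l, rfl⟩ := List.exists_cons_of_length_eq_add_one hl
    simp only [List.length_cons, add_left_inj] at hl
    rw [List.pairwise_cons] at hs
    have hsm : s ≤ m := hm s (by simp)
    by_cases hrs : s ≤ r
    · rw [← eMonomial_cons]
      refine Submodule.subset_span ⟨_, ⟨by simp [hl], ?_, ?_⟩, rfl⟩
      · rw [List.pairwise_cons, List.pairwise_cons]
        refine ⟨fun t ht => ?_, hs⟩
        rcases List.mem_cons.1 ht with rfl | ht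
        · exact hrs
        · exact (hs.1 t ht).trans hrs
      · intro t ht
        rcases List.mem_cons.1 ht with rfl | ht
        · exact hr
        · exact hm t ht
    · have hlm : eMonomial l ∈ Submodule.span QField (eMonomial '' decreasingLists N m) :=
        Submodule.subset_span ⟨l, ⟨hl, hs.2, fun t ht => hm t (by simp [ht])⟩, rfl⟩
      have key : ∀ c ≤ m, r < c → ∀ d ≤ m, eGen c * eGen d * eMonomial l ∈
          Submodule.span QField (eMonomial '' decreasingLists (N + 2) m) := by
        intro c hc hrc d hd'
        rw [mul_assoc]
        exact ihd _ (by omega) c hc rfl _ (ih d hd' _ hlm)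
      rw [eMonomial_cons, ← mul_assoc]
      obtain ⟨a, rfl⟩ : ∃ a, s = a + 1 := ⟨s - 1, by ring⟩
      by_cases har : a = r
      · subst har
        rw [eGen_mul_eGen_succ, smul_mul_assoc]
        exact Submodule.smul_mem _ _ (key _ hsm (by omega) _ hr)
      · rw [eGen_mul_eGen_of_lt, add_mul, sub_mul, smul_mul_assoc, smul_mul_assoc]
        exact add_mem (sub_mem (Submodule.smul_mem _ _ (key _ hsm (by omega) _ hr))
          (key _ (by omega) (by omega) _ (by omega)))
          (Submodule.smul_mem _ _ (key _ (by omega) (by omega) _ (by omega)))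

theorem eGen_mul_mem_span_succ (N : ℕ) (m : ℤ) (r : ℤ) (hr : r ≤ m) :
    ∀ x ∈ Submodule.span QField (eMonomial '' decreasingLists N m),
      eGen r * x ∈ Submodule.span QField (eMonomial '' decreasingLists (N + 1) m) := by
  induction N generalizing r with
  | zero =>
    intro x hx
    induction hx using Submodule.span_induction with
    | zero => simp
    | add x y _ _ hx hy => rw [mul_add]; exact add_mem hx hy
    | smul c x _ hx => rw [mul_smul_comm]; exact Submodule.smul_mem _ _ hx
    | mem x hx =>
      obtain ⟨l, ⟨hl, -, -⟩, rfl⟩ := hx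
      rw [List.length_eq_zero_iff] at hl
      subst hl
      rw [← eMonomial_cons]
      exact Submodule.subset_span ⟨_, ⟨rfl, by simp, by simpa using hr⟩, rfl⟩
  | succ N ih => exact eGen_mul_mem_span N m ih r hr

theorem eMonomial_mem_span (m : ℤ) (l : List ℤ) (hl : ∀ r ∈ l, r ≤ m) :
    eMonomial l ∈ Submodule.span QField (eMonomial '' decreasingLists l.length m) := by
  induction l with
  | nil => exact Submodule.subset_span ⟨[], ⟨rfl, by simp, by simp⟩, rfl⟩
  | cons r l ih =>
    rw [eMonomial_cons]
    exact eGen_mul_mem_span_succ _ m r (hl r (by simp)) _ (ih fun t ht => hl t (by simp [ht]))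

/-- Weakly decreasing lists of length `N`. -/
def sortedLists (N : ℕ) : Set (List ℤ) := {l | l.length = N ∧ l.Pairwise (· ≥ ·)}

/-- The homogeneous component of degree `N`. -/
noncomputable def gradedPiece (N : ℕ) : Submodule QField UPos :=
  Submodule.span QField (eMonomial '' {l | l.length = N})

theorem gradedPiece_le_span_sorted (N : ℕ) :
    gradedPiece N ≤ Submodule.span QField (eMonomial '' sortedLists N) := by
  refine Submodule.span_le.2 ?_
  rintro _ ⟨l, rfl, rfl⟩
  obtain ⟨m, hm⟩ : ∃ m : ℤ, ∀ r ∈ l, r ≤ m := by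
    obtain ⟨m, hm⟩ := l.toFinset.bddAbove
    exact ⟨m, fun r hr => hm (by simpa using hr)⟩
  have hsub : decreasingLists l.length m ⊆ sortedLists l.length := by
    rintro l' ⟨h1, h2, -⟩
    exact ⟨h1, h2⟩
  exact Submodule.span_mono (Set.image_mono hsub) (eMonomial_mem_span m l hm)

theorem eMonomial_append (l l' : List ℤ) :
    eMonomial (l ++ l') = eMonomial l * eMonomial l' := by
  simp [eMonomial]

theorem mul_mem_gradedPiece {M N : ℕ} {x y : UPos} (hx : x ∈ gradedPiece M)
    (hy : y ∈ gradedPiece N) : x * y ∈ gradedPiece (M + N) := by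
  have h := Submodule.mul_mem_mul hx hy
  rw [gradedPiece, gradedPiece, Submodule.span_mul_span] at h
  refine Submodule.span_mono ?_ h
  rintro _ ⟨_, ⟨l, hl, rfl⟩, _, ⟨l', hl', rfl⟩, rfl⟩
  simp only [Set.mem_ofPred_eq] at hl hl'
  exact ⟨l ++ l', by simp [hl, hl'], eMonomial_append l l'⟩

theorem eGen_mem_gradedPiece (r : ℤ) : eGen r ∈ gradedPiece 1 :=
  Submodule.subset_span ⟨[r], rfl, by simp [eMonomial]⟩

theorem mIter_mem_gradedPiece (m : ℤ) (j : ℕ) : mIter m j ∈ gradedPiece (j + 1) := by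
  induction j with
  | zero => exact eGen_mem_gradedPiece _
  | succ j ih =>
    refine sub_mem (mul_mem_gradedPiece ih (eGen_mem_gradedPiece _)) (Submodule.smul_mem _ _ ?_)
    rw [add_comm]
    exact mul_mem_gradedPiece (eGen_mem_gradedPiece _) ih

theorem mElt_mem_gradedPiece (k : ℕ) (n : ℤ) : mElt k n ∈ gradedPiece k := by
  cases k with
  | zero => exact Submodule.subset_span ⟨[], rfl, by simp [eMonomial, mElt]⟩
  | succ k => exact Submodule.smul_mem _ _ (mIter_mem_gradedPiece _ _)

end Spanning

/-! ### Constant terms of Laurent series. -/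

section ConstTerm

open Finset

variable {L : Type*} [Field L]

/-- A Laurent series is a power series with constant term `a`. -/
def HasConstTerm (y : LaurentSeries L) (a : L) : Prop :=
  ∃ p : PowerSeries L, HahnSeries.ofPowerSeries ℤ L p = y ∧ PowerSeries.constantCoeff p = a

/-- The uniformizer of the field of Laurent series. -/
noncomputable def laurentVar (L : Type*) [Field L] : LaurentSeries L := HahnSeries.single 1 1

theorem laurentVar_ne_zero : laurentVar L ≠ 0 := by
  simp [laurentVar]

namespace HasConstTerm

theorem C (a : L) : HasConstTerm (HahnSeries.C a) a :=
  ⟨PowerSeries.C a, HahnSeries.ofPowerSeries_C a, PowerSeries.constantCoeff_C a⟩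

theorem zero : HasConstTerm (0 : LaurentSeries L) 0 := ⟨0, map_zero _, map_zero _⟩

theorem one : HasConstTerm (1 : LaurentSeries L) 1 := ⟨1, map_one _, map_one _⟩

theorem laurentVar : HasConstTerm (laurentVar L) 0 :=
  ⟨PowerSeries.X, HahnSeries.ofPowerSeries_X, PowerSeries.constantCoeff_X⟩

theorem add {x y : LaurentSeries L} {a b : L} (hx : HasConstTerm x a) (hy : HasConstTerm y b) :
    HasConstTerm (x + y) (a + b) := by
  obtain ⟨p, rfl, rfl⟩ := hx
  obtain ⟨r, rfl, rfl⟩ := hy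
  exact ⟨p + r, map_add _ _ _, map_add _ _ _⟩

theorem sub {x y : LaurentSeries L} {a b : L} (hx : HasConstTerm x a) (hy : HasConstTerm y b) :
    HasConstTerm (x - y) (a - b) := by
  obtain ⟨p, rfl, rfl⟩ := hx
  obtain ⟨r, rfl, rfl⟩ := hy
  exact ⟨p - r, map_sub _ _ _, map_sub _ _ _⟩

theorem mul {x y : LaurentSeries L} {a b : L} (hx : HasConstTerm x a) (hy : HasConstTerm y b) :
    HasConstTerm (x * y) (a * b) := by
  obtain ⟨p, rfl, rfl⟩ := hx
  obtain ⟨r, rfl, rfl⟩ := hy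
  exact ⟨p * r, map_mul _ _ _, map_mul _ _ _⟩

theorem inv {x : LaurentSeries L} {a : L} (hx : HasConstTerm x a) (ha : a ≠ 0) :
    HasConstTerm x⁻¹ a⁻¹ := by
  obtain ⟨p, rfl, rfl⟩ := hx
  refine ⟨p⁻¹, ?_, PowerSeries.constantCoeff_inv p⟩
  refine eq_inv_of_mul_eq_one_left ?_
  rw [← map_mul, PowerSeries.inv_mul_cancel p ha, map_one]

theorem sum {α : Type*} (s : Finset α) {x : α → LaurentSeries L} {a : α → L}
    (h : ∀ i ∈ s, HasConstTerm (x i) (a i)) : HasConstTerm (∑ i ∈ s, x i) (∑ i ∈ s, a i) := by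
  classical
  induction s using Finset.induction_on with
  | empty => simpa using zero
  | insert i s hi ih =>
    rw [sum_insert hi, sum_insert hi]
    exact (h i (mem_insert_self i s)).add (ih fun j hj => h j (mem_insert_of_mem hj))

theorem prod {α : Type*} (s : Finset α) {x : α → LaurentSeries L} {a : α → L}
    (h : ∀ i ∈ s, HasConstTerm (x i) (a i)) : HasConstTerm (∏ i ∈ s, x i) (∏ i ∈ s, a i) := by
  classical
  induction s using Finset.induction_on with
  | empty => simpa using one
  | insert i s hi ih =>
    rw [prod_insert hi, prod_insert hi]
    exact (h i (mem_insert_self i s)).mul (ih fun j hj => h j (mem_insert_of_mem hj))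

theorem unique {x : LaurentSeries L} {a b : L} (h : HasConstTerm x a) (h' : HasConstTerm x b) :
    a = b := by
  obtain ⟨p, rfl, rfl⟩ := h
  obtain ⟨r, hr, rfl⟩ := h'
  rw [HahnSeries.ofPowerSeries_injective hr]

theorem pow_laurentVar (d : ℕ) (hd : d ≠ 0) : HasConstTerm (_root_.laurentVar L ^ d) 0 := by
  obtain ⟨d, rfl⟩ := Nat.exists_eq_succ_of_ne_zero hd
  refine ⟨PowerSeries.X ^ (d + 1), ?_, by simp⟩
  rw [map_pow, HahnSeries.ofPowerSeries_X]
  rfl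

end HasConstTerm

end ConstTerm

/-! ### Leading coefficients with one variable at infinity. -/

section Monomials

open Finset

variable {ι L : Type*} [DecidableEq ι] [Field L]

/-- The shuffle product of the one-variable monomials with exponents given by a list. -/
def shuffleMonomial (T : L) (z : ι → L) : List ℤ → Finset ι → L
  | [], S => if S = ∅ then 1 else 0
  | r :: l, S => ∑ a ∈ S, z a ^ r * (∏ b ∈ S.erase a, shuffleKer T z a b) *
      shuffleMonomial T z l (S.erase a)

/-- A family of elements of `L`, extended by one element at infinity. -/
noncomputable def extendFamily (z : ι → L) : Option ι → LaurentSeries L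
  | none => (laurentVar L)⁻¹
  | some i => HahnSeries.C (z i)

omit [DecidableEq ι] in
theorem shuffleKer_extend_some (T : L) (z : ι → L) (a b : ι) :
    shuffleKer (HahnSeries.C T) (extendFamily z) (some a) (some b)
      = HahnSeries.C (shuffleKer T z a b) := by
  simp [shuffleKer, extendFamily, map_mul, map_sub, map_inv₀]

theorem shuffleMonomial_extend_map (T : L) (z : ι → L) (l : List ℤ) (S : Finset ι) :
    shuffleMonomial (HahnSeries.C T) (extendFamily z) l (S.map Function.Embedding.some)
      = HahnSeries.C (shuffleMonomial T z l S) := by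
  induction l generalizing S with
  | nil =>
    simp only [shuffleMonomial, map_eq_empty]
    split_ifs <;> simp
  | cons r l ih =>
    simp only [shuffleMonomial, sum_map, map_sum, map_mul, map_prod]
    refine sum_congr rfl fun a _ => ?_
    have e : (S.map Function.Embedding.some).erase (Function.Embedding.some a)
        = (S.erase a).map Function.Embedding.some := by
      rw [map_erase]
    rw [e, ih, prod_map]
    congr 2
    · simp [extendFamily, map_zpow₀]
    · exact prod_congr rfl fun b _ => shuffleKer_extend_some T z a b

theorem insertNone_erase_none (S : Finset ι) :
    (insertNone S).erase none = S.map Function.Embedding.some := by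
  ext x; cases x <;> simp

theorem insertNone_erase_some (S : Finset ι) (a : ι) :
    (insertNone S).erase (some a) = insertNone (S.erase a) := by
  ext x; cases x <;> simp

omit [DecidableEq ι] in
theorem hasConstTerm_shuffleKer_none (T : L) (z : ι → L) (b : ι) :
    HasConstTerm (shuffleKer (HahnSeries.C T) (extendFamily z) none (some b) *
      (laurentVar L ^ 2)⁻¹) (-1) := by
  have h0 := laurentVar_ne_zero (L := L)
  have e : shuffleKer (HahnSeries.C T) (extendFamily z) none (some b) * (laurentVar L ^ 2)⁻¹
      = ((HahnSeries.C (z b) * laurentVar L - 1) *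
        (1 - HahnSeries.C T * HahnSeries.C (z b) * laurentVar L))⁻¹ := by
    rw [shuffleKer, ← mul_inv]
    congr 1
    simp only [extendFamily]
    field_simp
  rw [e]
  have h := ((((HasConstTerm.C (z b)).mul HasConstTerm.laurentVar).sub HasConstTerm.one).mul
    (HasConstTerm.one.sub
      (((HasConstTerm.C T).mul (HasConstTerm.C (z b))).mul HasConstTerm.laurentVar))).inv
    (by simp)
  simpa using h

omit [DecidableEq ι] in
theorem hasConstTerm_shuffleKer_some {T : L} (hT : T ≠ 0) (z : ι → L) (a : ι) :
    HasConstTerm (shuffleKer (HahnSeries.C T) (extendFamily z) (some a) none *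
      (laurentVar L ^ 2)⁻¹) (-T⁻¹) := by
  have h0 := laurentVar_ne_zero (L := L)
  have e : shuffleKer (HahnSeries.C T) (extendFamily z) (some a) none * (laurentVar L ^ 2)⁻¹
      = ((1 - HahnSeries.C (z a) * laurentVar L) *
        (HahnSeries.C (z a) * laurentVar L - HahnSeries.C T))⁻¹ := by
    rw [shuffleKer, ← mul_inv]
    congr 1
    simp only [extendFamily]
    field_simp
  rw [e]
  have h := ((HasConstTerm.one.sub ((HasConstTerm.C (z a)).mul HasConstTerm.laurentVar)).mul
    (((HasConstTerm.C (z a)).mul HasConstTerm.laurentVar).sub (HasConstTerm.C T))).inv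
    (by simpa using hT)
  simpa [inv_neg] using h

omit [DecidableEq ι] in
-- The new element has a pole while the others are constants, so no nonzero constant multiple of it
-- can equal a constant.
theorem isGenericFamily_extend {T : L} (hT : T ≠ 0) {z : ι → L} (hz : IsGenericFamily T z) :
    IsGenericFamily (HahnSeries.C T : LaurentSeries L) (extendFamily z) := by
  have h0 := laurentVar_ne_zero (L := L)
  have hC : Function.Injective (HahnSeries.C : L →+* LaurentSeries L) := HahnSeries.C_injective
  have key : ∀ c d : L, c ≠ 0 → HahnSeries.C c * (laurentVar L)⁻¹ ≠ HahnSeries.C d := by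
    intro c d hc h
    have h' : HahnSeries.C c = HahnSeries.C d * laurentVar L := by
      rw [← h, inv_mul_cancel_right₀ h0]
    have h1 := (HasConstTerm.C d).mul HasConstTerm.laurentVar
    rw [← h', mul_zero] at h1
    exact hc ((HasConstTerm.C c).unique h1)
  refine ⟨?_, ?_, ?_, ?_⟩
  · rintro (_ | i)
    · exact inv_ne_zero h0
    · exact (map_ne_zero _).2 (hz.ne_zero i)
  · rintro (_ | i) (_ | j) hij h
    · exact hij rfl
    · exact key 1 (z j) one_ne_zero (by simpa [extendFamily] using h)
    · exact key 1 (z i) one_ne_zero (by simpa [extendFamily] using h.symm)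
    · exact hz.ne i j (by simpa using hij) (hC h)
  · rintro (_ | i) (_ | j) hij h
    · exact hij rfl
    · exact key 1 (T * z j) one_ne_zero (by simpa [extendFamily] using h)
    · exact key T (z i) hT (by simpa [extendFamily] using h.symm)
    · exact hz.ne_mul i j (by simpa using hij) (hC (by simpa [extendFamily] using h))
  · rintro (_ | i) (_ | j) hij h
    · exact hij rfl
    · exact key 1 (T ^ 2 * z j) one_ne_zero (by simpa [extendFamily] using h)
    · exact key (T ^ 2) (z i) (pow_ne_zero 2 hT) (by simpa [extendFamily] using h.symm)
    · exact hz.ne_sq_mul i j (by simpa using hij) (hC (by simpa [extendFamily] using h))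

/-- The leading coefficient, in the variable at infinity, of a shuffle monomial with weakly
decreasing exponents. -/
theorem hasConstTerm_shuffleMonomial {T : L} (hT : T ≠ 0) (z : ι → L) (R : ℤ) (l : List ℤ)
    (hl : l.Pairwise (· ≥ ·)) (hR : ∀ r ∈ l, r ≤ R) (S : Finset ι) :
    HasConstTerm (shuffleMonomial (HahnSeries.C T) (extendFamily z) l (insertNone S) *
        laurentVar L ^ (R - 2 * (S.card : ℤ)))
      ((-1) ^ S.card * (∑ i ∈ range (l.count R), T⁻¹ ^ i) * shuffleMonomial T z l.tail S) := by
  have h0 := laurentVar_ne_zero (L := L)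
  induction l generalizing S with
  | nil => simpa [shuffleMonomial, insertNone_nonempty.ne_empty] using HasConstTerm.zero (L := L)
  | cons r l ih =>
    rw [List.pairwise_cons] at hl
    have hrR : r ≤ R := hR r (by simp)
    have ih := ih hl.2 fun s hs => hR s (by simp [hs])
    rw [shuffleMonomial, sum_insertNone, add_mul, sum_mul, insertNone_erase_none,
      shuffleMonomial_extend_map, prod_map]
    -- The variable at infinity takes the first letter. Each kernel decays like -Z⁻², so the term
    -- reaches the top order only if r = R.
    have hfirst : HasConstTerm (extendFamily z none ^ r * (∏ b ∈ S,
        shuffleKer (HahnSeries.C T) (extendFamily z) none (Function.Embedding.some b)) *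
        HahnSeries.C (shuffleMonomial T z l S) * laurentVar L ^ (R - 2 * (S.card : ℤ)))
        ((if r = R then 1 else 0) * (-1) ^ S.card * shuffleMonomial T z l S) := by
      have hpow : HasConstTerm (laurentVar L ^ (R - r).toNat) (if r = R then (1 : L) else 0) := by
        split_ifs with h
        · rw [h]; simpa using HasConstTerm.one
        · exact HasConstTerm.pow_laurentVar _ (by omega)
      have hprod := HasConstTerm.prod S fun b _ => hasConstTerm_shuffleKer_none T z b
      rw [prod_const] at hprod
      have h := (hpow.mul hprod).mul (HasConstTerm.C (shuffleMonomial T z l S))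
      convert h using 1
      rw [prod_mul_distrib, prod_const]
      have e1 : laurentVar L ^ (R - 2 * (S.card : ℤ)) = laurentVar L ^ r *
          laurentVar L ^ (R - r).toNat * ((laurentVar L ^ 2)⁻¹) ^ S.card := by
        rw [← zpow_natCast _ (R - r).toNat, Int.toNat_of_nonneg (by omega), inv_pow, ← pow_mul,
          ← zpow_natCast, ← zpow_neg, ← zpow_add₀ h0, ← zpow_add₀ h0]
        congr 1
        push_cast
        ring
      have e2 : extendFamily z none ^ r * laurentVar L ^ r = 1 := by
        simp only [extendFamily]
        rw [inv_zpow, inv_mul_cancel₀ (zpow_ne_zero _ h0)]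
      rw [e1]
      simp only [Function.Embedding.some_apply]
      linear_combination ((∏ b ∈ S, shuffleKer (HahnSeries.C T) (extendFamily z) none (some b)) *
        HahnSeries.C (shuffleMonomial T z l S) * laurentVar L ^ (R - r).toNat *
        ((laurentVar L ^ 2)⁻¹) ^ S.card) * e2
    -- A finite variable takes the first letter. Its kernel with infinity decays like -T⁻¹ Z⁻², so
    -- every letter passed contributes a factor T⁻¹.
    have hrest : ∀ a ∈ S, HasConstTerm (extendFamily z (some a) ^ r *
        (∏ b ∈ (insertNone S).erase (some a),
          shuffleKer (HahnSeries.C T) (extendFamily z) (some a) b) *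
        shuffleMonomial (HahnSeries.C T) (extendFamily z) l ((insertNone S).erase (some a)) *
        laurentVar L ^ (R - 2 * (S.card : ℤ)))
        ((-1) ^ S.card * T⁻¹ * (∑ i ∈ range (l.count R), T⁻¹ ^ i) *
          (z a ^ r * (∏ b ∈ S.erase a, shuffleKer T z a b) *
            shuffleMonomial T z l.tail (S.erase a))) := by
      intro a ha
      have hcard : S.card = (S.erase a).card + 1 := (card_erase_add_one ha).symm
      have h := ((HasConstTerm.C (z a ^ r)).mul ((hasConstTerm_shuffleKer_some hT z a).mul
        (HasConstTerm.C (∏ b ∈ S.erase a, shuffleKer T z a b)))).mul (ih (S.erase a))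
      convert h using 1
      · rw [insertNone_erase_some, prod_insertNone]
        have e1 : laurentVar L ^ (R - 2 * (S.card : ℤ)) = (laurentVar L ^ 2)⁻¹ *
            laurentVar L ^ (R - 2 * ((S.erase a).card : ℤ)) := by
          rw [← zpow_natCast, ← zpow_neg, ← zpow_add₀ h0, hcard]
          congr 1
          push_cast
          ring
        have e2 : ∏ b ∈ S.erase a, shuffleKer (HahnSeries.C T) (extendFamily z) (some a) (some b)
            = HahnSeries.C (∏ b ∈ S.erase a, shuffleKer T z a b) := by
          rw [map_prod]
          exact prod_congr rfl fun b _ => shuffleKer_extend_some T z a b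
        rw [e1, e2, map_zpow₀, extendFamily]
        ring
      · rw [hcard, pow_succ]
        ring
    convert hfirst.add (HasConstTerm.sum S hrest) using 1
    rw [← mul_sum, List.tail_cons]
    by_cases hr : r = R
    · subst hr
      rw [List.count_cons_self, sum_range_succ', if_pos rfl]
      by_cases hc : l.count r = 0
      · simp [hc]
      -- If R occurs again, sortedness makes it the next letter. Removing any one of the leading
      -- copies of R therefore leaves the same list, and the powers of T⁻¹ add up on a single
      -- shuffle monomial.
      · have hl' : l = r :: l.tail := by
          cases l with
          | nil => simp at hc
          | cons s l =>
            have hmem : r ∈ s :: l := List.count_pos_iff.1 (Nat.pos_of_ne_zero hc)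
            have h1 : s ≤ r := hR s (by simp)
            have h2 : r ≤ s := by
              rcases List.mem_cons.1 hmem with h | h
              · exact h.le
              · exact (List.pairwise_cons.1 hl.2).1 r h
            rw [le_antisymm h1 h2, List.tail_cons]
        have hM : shuffleMonomial T z l S = ∑ a ∈ S, z a ^ r *
            (∏ b ∈ S.erase a, shuffleKer T z a b) * shuffleMonomial T z l.tail (S.erase a) := by
          conv_lhs => rw [hl', shuffleMonomial]
        rw [← hM]
        simp only [pow_succ, ← sum_mul]
        ring
    · have hc : l.count R = 0 := List.count_eq_zero.2 fun h => hr (le_antisymm hrR (hl.1 R h))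
      rw [List.count_cons_of_ne hr, hc, if_neg hr]
      simp

end Monomials

/-! ### Linear independence of the sorted shuffle monomials. -/

section Independence

open Finset

theorem sum_inv_pow_ne_zero {k : Type*} [Field k] {t : k} (ht : ∀ n : ℕ, n ≠ 0 → t ^ n ≠ 1)
    {n : ℕ} (hn : n ≠ 0) : ∑ i ∈ range n, t⁻¹ ^ i ≠ 0 := by
  intro h
  have h1 := geom_sum_mul t⁻¹ n
  rw [h, zero_mul, inv_pow, eq_comm, sub_eq_zero, inv_eq_one] at h1
  exact ht n hn h1

/-- The witness is an N-fold iterated Laurent series field, each layer adding a variable at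
infinity. In a relation, the top order in the newest variable sees only lists with the largest head,
and gives a relation between their tails. -/
theorem exists_shuffleMonomial_independent {k : Type} [Field k] {t : k} (ht0 : t ≠ 0)
    (ht : ∀ n : ℕ, n ≠ 0 → t ^ n ≠ 1) (N : ℕ) :
    ∃ (ι : Type) (_ : Fintype ι) (_ : DecidableEq ι) (L : Type) (_ : Field L) (f : k →+* L)
      (z : ι → L), IsGenericFamily (f t) z ∧ ∀ (A : Finset (List ℤ)) (c : List ℤ → k),
        (∀ l ∈ A, l ∈ sortedLists N) →
        ∑ l ∈ A, f (c l) * shuffleMonomial (f t) z l univ = 0 → ∀ l ∈ A, c l = 0 := by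
  classical
  induction N with
  | zero =>
    refine ⟨Empty, inferInstance, inferInstance, k, inferInstance, RingHom.id k, Empty.elim,
      ⟨fun i => i.elim, fun i => i.elim, fun i => i.elim, fun i => i.elim⟩, ?_⟩
    intro A c hA h l hl
    have hnil : ∀ l ∈ A, l = [] := fun l hl => List.length_eq_zero_iff.1 (hA l hl).1
    have hA' : A = {[]} := by
      ext l'
      simp only [mem_singleton]
      exact ⟨hnil l', fun h => by rw [h, ← hnil l hl]; exact hl⟩
    rw [hA'] at h
    rw [hnil l hl]
    simpa [shuffleMonomial] using h
  | succ N ih =>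
    obtain ⟨ι, _, _, L, _, f, z, hz, hind⟩ := ih
    have hT : f t ≠ 0 := (map_ne_zero f).2 ht0
    refine ⟨Option ι, inferInstance, inferInstance, LaurentSeries L, inferInstance,
      HahnSeries.C.comp f, extendFamily z, isGenericFamily_extend hT hz, ?_⟩
    intro A c hA h
    by_contra! hne
    obtain ⟨l₁, hl₁, hcl₁⟩ := hne
    -- All lists here have length N + 1, so the default 0 for the head is never used.
    obtain ⟨l₀, hl₀, hmax⟩ := exists_max_image (A.filter fun l => c l ≠ 0) (fun l => l.headD 0)
      ⟨l₁, mem_filter.2 ⟨hl₁, hcl₁⟩⟩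
    set B := A.filter fun l => c l ≠ 0 with hB
    set R := l₀.headD 0 with hRdef
    have hsort : ∀ l ∈ B, l.length = N + 1 ∧ l.Pairwise (· ≥ ·) ∧ ∀ r ∈ l, r ≤ l.headD 0 := by
      intro l hl
      obtain ⟨h1, h2⟩ := hA l (mem_filter.1 hl).1
      refine ⟨h1, h2, ?_⟩
      cases l with
      | nil => simp
      | cons s l =>
        intro r hr
        rcases List.mem_cons.1 hr with rfl | hr
        · simp
        · exact (List.pairwise_cons.1 h2).1 r hr
    have hcons : ∀ l ∈ B.filter (fun l => l.headD 0 = R), l = R :: l.tail := by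
      intro l hl
      obtain ⟨hl, hh⟩ := mem_filter.1 hl
      obtain ⟨s, l', rfl⟩ := List.exists_cons_of_length_eq_add_one (hsort l hl).1
      simpa using hh
    have hBsum : ∑ l ∈ B, f (c l) * ((-1) ^ (univ : Finset ι).card *
        (∑ i ∈ range (l.count R), (f t)⁻¹ ^ i) * shuffleMonomial (f t) z l.tail univ) = 0 := by
      have hterm := HasConstTerm.sum B fun l hl => (HasConstTerm.C (f (c l))).mul
        (hasConstTerm_shuffleMonomial hT z R l (hsort l hl).2.1
          (fun r hr => ((hsort l hl).2.2 r hr).trans (hmax l hl)) univ)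
      refine hterm.unique ?_
      have hzero : ∑ l ∈ B, HahnSeries.C (f (c l)) * (shuffleMonomial (HahnSeries.C (f t))
          (extendFamily z) l (insertNone univ) *
            laurentVar L ^ (R - 2 * ((univ : Finset ι).card : ℤ))) = 0 := by
        simp only [← mul_assoc]
        rw [← sum_mul, hB, sum_filter_of_ne, ← univ_option]
        · have h' := h
          simp only [RingHom.comp_apply] at h'
          rw [h', zero_mul]
        · intro l _ hl hc
          rw [hc, map_zero, map_zero, zero_mul] at hl
          exact hl rfl
      rw [hzero]
      exact HasConstTerm.zero
    -- With the head fixed to R, the tail determines the list, so no coefficients merge when passing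
    -- to tails.
    have hinj : Set.InjOn List.tail (↑(B.filter fun l => l.headD 0 = R) : Set (List ℤ)) := by
      intro l hl l' hl' h
      rw [hcons l hl, hcons l' hl', h]
    have hBsum' : ∑ l ∈ (B.filter fun l => l.headD 0 = R).image List.tail,
        f (c (R :: l) * ∑ i ∈ range ((R :: l).count R), t⁻¹ ^ i) *
          shuffleMonomial (f t) z l univ = 0 := by
      rw [sum_image hinj]
      have hs : ((-1 : L) ^ (univ : Finset ι).card) ≠ 0 := pow_ne_zero _ (by simp)
      refine (mul_eq_zero.1 ((Eq.trans ?_ hBsum) : ((-1 : L) ^ (univ : Finset ι).card) * _ = 0)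
        ).resolve_left hs
      rw [mul_sum, ← sum_filter_of_ne (s := B) (p := fun l => l.headD 0 = R)]
      · refine sum_congr rfl fun l hl => ?_
        rw [← hcons l hl, map_mul, map_sum]
        simp only [map_pow, map_inv₀]
        ring
      · intro l hl hne
        by_contra hlR
        have hlt : l.headD 0 < R := lt_of_le_of_ne (hmax l hl) hlR
        have hc : l.count R = 0 := List.count_eq_zero.2 fun hm =>
          absurd ((hsort l hl).2.2 R hm) (not_le.2 hlt)
        rw [hc] at hne
        simp at hne
    have hl₀' : l₀ ∈ B.filter fun l => l.headD 0 = R := mem_filter.2 ⟨hl₀, rfl⟩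
    have hfin := hind _ (fun l => c (R :: l) * ∑ i ∈ range ((R :: l).count R), t⁻¹ ^ i) (by
      intro l hl
      obtain ⟨l', hl', rfl⟩ := mem_image.1 hl
      obtain ⟨h1, h2, -⟩ := hsort l' (mem_filter.1 hl').1
      rw [hcons l' hl'] at h1 h2
      exact ⟨by simpa using h1, (List.pairwise_cons.1 h2).2⟩) hBsum' l₀.tail
      (mem_image_of_mem _ hl₀')
    rw [← hcons l₀ hl₀'] at hfin
    refine (mul_ne_zero (mem_filter.1 hl₀).2 (sum_inv_pow_ne_zero ht ?_)) hfin
    rw [hcons l₀ hl₀']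
    simp

end Independence

/-! ### Faithfulness on homogeneous elements. -/

section Faithful

open Finset

theorem shuffleRep_eMonomial_apply {ι L : Type*} [DecidableEq ι] [Field L] [Algebra QField L]
    (z : ι → L) (hz : IsGenericFamily (algebraMap QField L qFrak) z) (l : List ℤ) :
    shuffleRep z hz (eMonomial l) (fun S => if S = ∅ then 1 else 0)
      = shuffleMonomial (algebraMap QField L qFrak) z l := by
  induction l with
  | nil => simp [eMonomial, shuffleMonomial]
  | cons r l ih =>
    rw [eMonomial_cons, map_mul, Module.End.mul_apply, ih, shuffleRep_eGen]
    funext S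
    rw [shuffleEnd_apply, shuffleConv_monomialFun_one, shuffleMonomial]

/-- A homogeneous element acting by zero in every shuffle representation vanishes. -/
theorem eq_zero_of_shuffleRep_eq_zero {N : ℕ} {x : UPos} (hx : x ∈ gradedPiece N)
    (h : ∀ (ι L : Type) [DecidableEq ι] [Field L] [Algebra QField L] (z : ι → L)
      (hz : IsGenericFamily (algebraMap QField L qFrak) z), shuffleRep z hz x = 0) : x = 0 := by
  obtain ⟨ι, _, _, L, _, f, z, hz, hind⟩ := exists_shuffleMonomial_independent qFrak_ne_zero
    (fun n hn => qFrak_pow_ne_one hn) N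
  let _ : Algebra QField L := f.toAlgebra
  obtain ⟨c, hc, rfl⟩ := (Finsupp.mem_span_image_iff_linearCombination QField).1
    (gradedPiece_le_span_sorted N hx)
  -- Acting on the vacuum, the indicator of the empty set, turns monomials of the algebra into
  -- shuffle monomials; evaluating at all variables gives the relation to which independence
  -- applies.
  have h0 := congrFun (LinearMap.congr_fun (h ι L z hz) fun S => if S = ∅ then 1 else 0) univ
  rw [Finsupp.linearCombination_apply, Finsupp.sum, map_sum, LinearMap.sum_apply] at h0
  have hzero := hind c.support c (fun l hl => hc hl) (by
    rw [Finset.sum_apply] at h0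
    refine Eq.trans (sum_congr rfl fun l _ => ?_) h0
    rw [map_smul, LinearMap.smul_apply, shuffleRep_eMonomial_apply, Pi.smul_apply,
      Algebra.smul_def]
    rfl)
  have : c = 0 := by
    ext l
    by_contra hl
    exact hl (hzero l (Finsupp.mem_support_iff.2 hl))
  rw [this, map_zero]

end Faithful

/-! ### The M-system relation. -/

theorem proposition6p7 (α : ℕ) (hα : 1 ≤ α) (n : ℤ) :
    mElt α n ^ 2 - qFrak ^ α • (mElt α (n + 1) * mElt α (n - 1))
      = mElt (α + 1) n * mElt (α - 1) n := by
  obtain ⟨m, rfl⟩ : ∃ m, α = m + 1 := ⟨α - 1, by omega⟩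
  rw [Nat.add_sub_cancel, ← sub_eq_zero, sq]
  refine eq_zero_of_shuffleRep_eq_zero (N := m + 1 + (m + 1)) ?_ ?_
  · refine sub_mem (sub_mem (mul_mem_gradedPiece (mElt_mem_gradedPiece _ _)
      (mElt_mem_gradedPiece _ _)) (Submodule.smul_mem _ _ (mul_mem_gradedPiece
        (mElt_mem_gradedPiece _ _) (mElt_mem_gradedPiece _ _)))) ?_
    rw [show m + 1 + (m + 1) = m + 1 + 1 + m by ring]
    exact mul_mem_gradedPiece (mElt_mem_gradedPiece _ _) (mElt_mem_gradedPiece _ _)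
  · intro ι L _ _ _ z hz
    have inj := (algebraMap QField L).injective
    have hT0 : algebraMap QField L qFrak ≠ 0 := (map_ne_zero _).2 qFrak_ne_zero
    have hTn : ∀ d : ℕ, d ≠ 0 → algebraMap QField L qFrak ^ d ≠ 1 := fun d hd h => by
      rw [← map_pow, ← map_one (algebraMap QField L)] at h
      exact qFrak_pow_ne_one hd (inj h)
    -- The exponent a = -n - m is that of M_{m+1,n}. Those of M_{m+1,n+1} and M_{m+2,n} are a - 1,
    -- and those of M_{m+1,n-1} and M_{m,n} are a + 1.
    have h := monomialFun_relation hT0 (by simpa using hTn 1 one_ne_zero) (hTn 2 two_ne_zero) hz m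
      (-n - m)
    rw [map_sub, map_sub, map_smul, map_mul, map_mul, map_mul]
    simp only [shuffleRep_mElt, shuffleEnd_mul]
    rw [← shuffleEnd_smul, ← shuffleEnd_sub, sub_eq_zero]
    congr 1
    rw [show -n - ((m + 1 : ℕ) : ℤ) + 1 = -n - m by push_cast; ring,
      show -(n + 1) - ((m + 1 : ℕ) : ℤ) + 1 = -n - m - 1 by push_cast; ring,
      show -(n - 1) - ((m + 1 : ℕ) : ℤ) + 1 = -n - m + 1 by push_cast; ring,
      show -n - ((m + 1 + 1 : ℕ) : ℤ) + 1 = -n - m - 1 by push_cast; ring, ← h]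
    funext S
    simp only [Pi.sub_apply, Pi.smul_apply]
    simp only [Algebra.smul_def, map_pow]
    rfl
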